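/- Let $\hat K=[0,1]^2$ and let $Q_{r,s}$ be the space of real polynomials in $(x,y)$ of degree at most $r$ in $x$ and at most $s$ in $y$ (with $Q_{-1,s}=Q_{r,-1}=\{0\}$). For an integer $k\ge 0$ let $RT_k=Q_{k+1,k}\times Q_{k,k+1}$. For a field $\mathbf v\in C(\hat K)^2$ (or, more generally, $\mathbf v\in L^1(\hat K)^2$ with integrable values of $\mathbf v\cdot\mathbf n$ given on each edge) the Raviart–Thomas interpolant $\hat I_{RT}\mathbf v\in RT_k$ is determined by $$\int_{\hat F}(\hat I_{RT}\mathbf v-\mathbf v)\cdot\mathbf n\,q=0\quad\text{for all edges }\hat F\text{ of }\hat K\text{ and all polynomials }q\text{ of degree at most }k\text{ on }\hat F,$$ $$\int_{\hat K}(\hat I_{RT}\mathbf v-\mathbf v)\cdot\mathbf q=0\quad\text{for all }\mathbf q\in Q_{k-1,k}\times Q_{k,k-1},$$ where $\mathbf n$ is the outer unit normal. **Theorem.** These conditions determine a unique $\hat I_{RT}\mathbf v\in RT_k$. Moreover, let $1\le\ell\le k+1$ and $p\in[1,\infty)$. There is a constant $C>0$, depending only on $k$, $\ell$ and $p$, such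 that every $\mathbf u\in C(\hat K)^2$ whose weak divergence belongs to $W^{\ell,p}(\hat K)$ satisfies $$\|\operatorname{div}(\mathbf u-\hat I_{RT}\mathbf u)\|_{L^p(\hat K)}\le C\left(\|\partial_x^\ell\operatorname{div}\mathbf u\|_{L^p(\hat K)}+\|\partial_y^\ell\operatorname{div}\mathbf u\|_{L^p(\hat K)}\right).$$ With the same $C$, this estimate holds for every $\mathbf u\in L^1(\hat K)^2$ with weak divergence in $W^{\ell,p}(\hat K)$ that has an integrable normal trace, that is, integrable functions $\mathbf u\cdot\mathbf n$ on the four edges such that $\int_{\hat K}(\mathbf u\cdot\nabla\varphi+\varphi\operatorname{div}\mathbf u)=\int_{\partial\hat K}(\mathbf u\cdot\mathbf n)\,\varphi$ for all $\varphi\in C^\infty(\mathbb R^2)$; its interpolant is formed with this normal trace. -/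

import Mathlib

namespace RaviartThomas

noncomputable section

open MeasureTheory Set
open scoped ContDiff

/-- The closed reference square `[0,1]²`. -/
def closedSquare : Set (ℝ × ℝ) := Icc (0 : ℝ) 1 ×ˢ Icc (0 : ℝ) 1

/-- The open reference square `(0,1)²`. -/
def openSquare : Set (ℝ × ℝ) := Ioo (0 : ℝ) 1 ×ˢ Ioo (0 : ℝ) 1

/-- Two-dimensional Lebesgue measure on the reference square. -/
def squareMeasure : Measure (ℝ × ℝ) := (volume : Measure (ℝ × ℝ)).restrict closedSquare

/-- The Euclidean scalar product of two vectors in the plane. -/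
def dot (a b : ℝ × ℝ) : ℝ := a.1 * b.1 + a.2 * b.2

/-- The classical partial derivative with respect to the first variable. -/
def partialX (φ : ℝ × ℝ → ℝ) (z : ℝ × ℝ) : ℝ := fderiv ℝ φ z (1, 0)

/-- The classical partial derivative with respect to the second variable. -/
def partialY (φ : ℝ × ℝ → ℝ) (z : ℝ × ℝ) : ℝ := fderiv ℝ φ z (0, 1)

/-- The classical gradient. -/
def grad (φ : ℝ × ℝ → ℝ) (z : ℝ × ℝ) : ℝ × ℝ := (partialX φ z, partialY φ z)

/-- Test functions: smooth functions whose support is a compact subset of the open square. -/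
def IsTest (φ : ℝ × ℝ → ℝ) : Prop :=
  ContDiff ℝ ∞ φ ∧ HasCompactSupport φ ∧ tsupport φ ⊆ openSquare

/-- `g` is the weak derivative `∂ₓᵃ ∂ᵧᵇ f` on the open square. -/
def HasWeakDeriv (a b : ℕ) (f g : ℝ × ℝ → ℝ) : Prop :=
  LocallyIntegrableOn f openSquare volume ∧ LocallyIntegrableOn g openSquare volume ∧
    ∀ φ : ℝ × ℝ → ℝ, IsTest φ →
      ∫ z in openSquare, f z * partialX^[a] (partialY^[b] φ) z =
        (-1 : ℝ) ^ (a + b) * ∫ z in openSquare, g z * φ z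

/-- `d` is the weak divergence of the vector field `u` on the open square. -/
def HasWeakDiv (u : ℝ × ℝ → ℝ × ℝ) (d : ℝ × ℝ → ℝ) : Prop :=
  LocallyIntegrableOn u openSquare volume ∧ LocallyIntegrableOn d openSquare volume ∧
    ∀ φ : ℝ × ℝ → ℝ, IsTest φ →
      ∫ z in openSquare, dot (u z) (grad φ z) = -∫ z in openSquare, d z * φ z

/-- The Sobolev space `W^{ℓ,p}` of the square: all weak derivatives up to order `ℓ` are in `L^p`. -/
def MemSobolev (ℓ : ℕ) (p : ENNReal) (f : ℝ × ℝ → ℝ) : Prop :=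
  MemLp f p squareMeasure ∧
    ∀ a b : ℕ, a + b ≤ ℓ → ∃ g : ℝ × ℝ → ℝ, MemLp g p squareMeasure ∧ HasWeakDeriv a b f g

/-- The polynomials of degree less than `m` in `x` and less than `n` in `y`. Hence `Q_{r,s}` is
`polyLT (r + 1) (s + 1)`, and it is the zero space when `r = -1` or `s = -1`. -/
def polyLT (m n : ℕ) : Submodule ℝ (ℝ × ℝ → ℝ) :=
  Submodule.span ℝ
    {f | ∃ i j : ℕ, i < m ∧ j < n ∧ f = fun z : ℝ × ℝ => z.1 ^ i * z.2 ^ j}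

/-- `w` belongs to the Raviart–Thomas space `RT_k = Q_{k+1,k} × Q_{k,k+1}`. -/
def MemRT (k : ℕ) (w : ℝ × ℝ → ℝ × ℝ) : Prop :=
  (fun z => (w z).1) ∈ polyLT (k + 2) (k + 1) ∧ (fun z => (w z).2) ∈ polyLT (k + 1) (k + 2)

/-- The interior test space `Q_{k-1,k} × Q_{k,k-1}` (the zero space when `k = 0`). -/
def MemInteriorTest (k : ℕ) (q : ℝ × ℝ → ℝ × ℝ) : Prop :=
  (fun z => (q z).1) ∈ polyLT k (k + 1) ∧ (fun z => (q z).2) ∈ polyLT (k + 1) k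

/-- The four faces of the square. -/
inductive Face
  | left
  | right
  | bottom
  | top

/-- The parametrization of a face by arc length, over `[0,1]`. -/
def Face.param : Face → ℝ → ℝ × ℝ
  | .left, t => (0, t)
  | .right, t => (1, t)
  | .bottom, t => (t, 0)
  | .top, t => (t, 1)

/-- The outer unit normal of a face. -/
def Face.normal : Face → ℝ × ℝ
  | .left => (-1, 0)
  | .right => (1, 0)
  | .bottom => (0, -1)
  | .top => (0, 1)

/-- `v · n` on a face, as a function of arc length. -/
def normalComp (v : ℝ × ℝ → ℝ × ℝ) (F : Face) (t : ℝ) : ℝ := dot (v (F.param t)) F.normal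

/-- The moments that define the interpolant make sense for `v`: `v` is integrable over the square
and `v · n` is integrable over every face. -/
def HasMoments (v : ℝ × ℝ → ℝ × ℝ) : Prop :=
  IntegrableOn v closedSquare volume ∧
    ∀ F : Face, IntervalIntegrable (normalComp v F) volume 0 1

/-- `w` is the Raviart–Thomas interpolant of degree `k` of `v`. -/
def IsRTInterpolant (k : ℕ) (v w : ℝ × ℝ → ℝ × ℝ) : Prop :=
  MemRT k w ∧
    (∀ F : Face, ∀ q : Polynomial ℝ, q.natDegree ≤ k →
      ∫ t in (0 : ℝ)..1, normalComp (fun z => w z - v z) F t * q.eval t = 0) ∧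
    ∀ q : ℝ × ℝ → ℝ × ℝ, MemInteriorTest k q →
      ∫ z in closedSquare, dot (w z - v z) (q z) = 0

/-- The values of `u · n` on the four faces form the normal trace of the field `u` with
divergence `d`, in the usual weak sense of Green's formula. (The faces are null sets, so the
values there are extra data for a field that is only given almost everywhere.) -/
def HasNormalTrace (u : ℝ × ℝ → ℝ × ℝ) (d : ℝ × ℝ → ℝ) : Prop :=
  ∀ φ : ℝ × ℝ → ℝ, ContDiff ℝ ∞ φ →
    (∫ z in closedSquare, dot (u z) (grad φ z)) + ∫ z in closedSquare, d z * φ z =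
      (∫ t in (0 : ℝ)..1, normalComp u .left t * φ (Face.left.param t)) +
      (∫ t in (0 : ℝ)..1, normalComp u .right t * φ (Face.right.param t)) +
      (∫ t in (0 : ℝ)..1, normalComp u .bottom t * φ (Face.bottom.param t)) +
      ∫ t in (0 : ℝ)..1, normalComp u .top t * φ (Face.top.param t)

/-- Continuous fields on the closed square have all moments. -/
theorem hasMoments_of_continuousOn {v : ℝ × ℝ → ℝ × ℝ} (hv : ContinuousOn v closedSquare) :
    HasMoments v := by
  refine ⟨hv.integrableOn_compact (isCompact_Icc.prod isCompact_Icc), fun F => ?_⟩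
  apply ContinuousOn.intervalIntegrable
  rw [uIcc_of_le zero_le_one]
  have hm : MapsTo F.param (Icc 0 1) closedSquare := by
    intro t ht
    cases F <;> simp_all [Face.param, closedSquare]
  have hp : Continuous F.param := by
    cases F
    · exact continuous_const.prodMk continuous_id
    · exact continuous_const.prodMk continuous_id
    · exact continuous_id.prodMk continuous_const
    · exact continuous_id.prodMk continuous_const
  have h : ContinuousOn (fun t => v (F.param t)) (Icc 0 1) := hv.comp hp.continuousOn hm
  exact (h.fst.mul continuousOn_const).add (h.snd.mul continuousOn_const)

end

end RaviartThomas

/-!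
The degrees of freedom of the Raviart–Thomas space decouple. The first component of a field in
`RT_k` is a polynomial with a coefficient matrix `c`, and its degrees of freedom are the entries of
`E c Nᵀ`: here `E` collects the two endpoint values and the first `k` moments of the monomials of
degree at most `k + 1`, and `N` is the Gram matrix of the monomials of degree at most `k`. Both are
invertible (`isUnit_endpointMatrix`, `isUnit_gramMatrix`), so the interpolant exists and is unique
(`existsUnique_isRTInterpolant`); the second component is the reflection of the first.

For the estimate, Green's formula shows that `div w` is the `L²` projection of `d = div u` onto
`Q_{k,k}` (`IsRTInterpolant.integral_divergence_mul`). For a field that is continuous up to the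
boundary, Green's formula follows from the weak divergence by cutting off near the boundary
(`hasNormalTrace_of_continuousOn`).

It remains to approximate `d` by polynomials with only the pure derivatives of order `ℓ`. Let `Π` be
the averaged projection `f ↦ ∑ⱼ xʲ ∫ ηⱼ(t) f(t, y) dt`, where the smooth functions `ηⱼ` have compact
support in `(0, 1)` and are dual to the monomials of degree less than `ℓ`. The adjoint of `1 - Π`
subtracts from a test function `ψ` its moments on horizontal lines, and the remainder is the `ℓ`-th
`x`-derivative of a test function, namely of its iterated primitive (`IsTest.iterate_xPrimitive`).
By duality, `d - Π d = ± (1 - Π) T^ℓ (∂ₓ^ℓ d)` almost everywhere, where `T` is integration from `x`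
to `1` (`sub_polyKernel_eq_of_hasXDeriv`). So `d - Π d` is bounded on each horizontal line by a
multiple of the `L¹` norm of `∂ₓ^ℓ d` on that line. Applying this in both variables gives a
polynomial `q` in `Q_{ℓ-1,ℓ-1}` with a bound for `d - q` (`abs_sub_projection_le`). The polynomial
`div w - q` has the moments of `d - q` against `Q_{k,k}`, which bounds it by the `L¹` norm of
`d - q` (`exists_bound_of_moments`). Jensen's inequality turns the bound on lines into the bound in `L^p`.
-/

namespace RaviartThomas

open MeasureTheory Set
open scoped ContDiff

/-! ### Primitives of test functions in the first variable -/

/-- Test functions are the smooth functions vanishing outside some smaller closed square. -/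
theorem isTest_iff {φ : ℝ × ℝ → ℝ} :
    IsTest φ ↔ ContDiff ℝ ∞ φ ∧
      ∃ a : ℝ, 0 < a ∧ ∀ z, z ∉ Icc a (1 - a) ×ˢ Icc a (1 - a) → φ z = 0 := by
  constructor
  · rintro ⟨hs, hc, ht⟩
    refine ⟨hs, ?_⟩
    have ho : IsOpen openSquare := isOpen_Ioo.prod isOpen_Ioo
    obtain ⟨δ, hδ, hsub⟩ := IsCompact.exists_thickening_subset_open hc ho ht
    refine ⟨δ / 2, by positivity, fun z hz => ?_⟩
    by_contra hne
    apply hz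
    have hzt : z ∈ tsupport φ := subset_tsupport φ hne
    have key : ∀ w : ℝ × ℝ, dist w z < δ → w ∈ openSquare := fun w hw =>
      hsub (Metric.mem_thickening_iff.2 ⟨z, hzt, hw⟩)
    have h1 := key (z.1 - δ / 2, z.2 - δ / 2) (by
      rw [Prod.dist_eq, Real.dist_eq, Real.dist_eq]
      simp only [sub_sub_cancel_left, abs_neg, max_self]
      rw [abs_of_pos (by positivity)]; linarith)
    have h2 := key (z.1 + δ / 2, z.2 + δ / 2) (by
      rw [Prod.dist_eq, Real.dist_eq, Real.dist_eq]
      simp only [add_sub_cancel_left, max_self]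
      rw [abs_of_pos (by positivity)]; linarith)
    simp only [openSquare, mem_prod, mem_Ioo] at h1 h2
    simp only [mem_prod, mem_Icc]
    refine ⟨⟨?_, ?_⟩, ?_, ?_⟩ <;> linarith
  · rintro ⟨hs, a, ha, hz⟩
    have hsupp : tsupport φ ⊆ Icc a (1 - a) ×ˢ Icc a (1 - a) := by
      refine closure_minimal (fun z hz' => ?_) (isClosed_Icc.prod isClosed_Icc)
      by_contra hcon
      exact hz' (hz z hcon)
    refine ⟨hs, HasCompactSupport.of_support_subset_isCompact (isCompact_Icc.prod isCompact_Icc)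
      ((subset_tsupport φ).trans hsupp), hsupp.trans ?_⟩
    rintro z ⟨h1, h2⟩
    exact ⟨⟨ha.trans_le h1.1, by linarith [h1.2]⟩, ⟨ha.trans_le h2.1, by linarith [h2.2]⟩⟩

/-- The primitive in the first variable that vanishes on the left face. -/
noncomputable def xPrimitive (h : ℝ × ℝ → ℝ) (z : ℝ × ℝ) : ℝ := ∫ t in (0 : ℝ)..z.1, h (t, z.2)

/-- The `i`-th moment of a function in the first variable, as a function of the second one. -/
noncomputable def xMoment (i : ℕ) (h : ℝ × ℝ → ℝ) (y : ℝ) : ℝ :=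
  ∫ t in (0 : ℝ)..1, t ^ i * h (t, y)

/-- The primitive is the convolution with the Heaviside function, with the second variable as a
parameter. -/
theorem IsTest.contDiff_xPrimitive {h : ℝ × ℝ → ℝ} (hh : IsTest h) :
    ContDiff ℝ ∞ (xPrimitive h) := by
  obtain ⟨hs, a, ha, hz⟩ := isTest_iff.1 hh
  set f : ℝ → ℝ := (Ioi (0 : ℝ)).indicator 1 with hf
  have hfl : LocallyIntegrable f volume :=
    (locallyIntegrable_const (1 : ℝ)).indicator measurableSet_Ioi
  have key := contDiffOn_convolution_right_with_param (𝕜 := ℝ) (μ := (volume : Measure ℝ))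
    (f := f) (n := (⊤ : ℕ∞)) (ContinuousLinearMap.mul ℝ ℝ) (g := fun y t => h (t, y))
    (s := univ) (k := Icc a (1 - a)) isOpen_univ isCompact_Icc
    (fun y t _ ht => hz _ (fun hm => ht hm.1)) hfl
    (by
      apply ContDiff.contDiffOn
      exact hs.comp (contDiff_snd.prodMk contDiff_fst))
  rw [univ_prod_univ, contDiffOn_univ] at key
  have hswap : ContDiff ℝ ∞ fun z : ℝ × ℝ => (z.2, z.1) := contDiff_snd.prodMk contDiff_fst
  have h2 := key.comp hswap
  convert h2 using 1
  ext ⟨x, y⟩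
  simp only [xPrimitive, Function.comp, convolution_def, ContinuousLinearMap.mul_apply']
  have hL : (∫ t in (0 : ℝ)..x, h (t, y)) = ∫ t in Iic x, h (t, y) := by
    have hint : ∀ s : Set ℝ, IntegrableOn (fun t => h (t, y)) s := fun s => by
      apply Integrable.integrableOn
      apply Continuous.integrable_of_hasCompactSupport
      · exact hs.continuous.comp (by fun_prop)
      · refine HasCompactSupport.of_support_subset_isCompact (isCompact_Icc (a := a) (b := 1 - a))
          fun t ht => ?_
        by_contra hcon
        exact ht (hz _ fun hm => hcon hm.1)
    rw [← intervalIntegral.integral_Iic_sub_Iic (hint _) (hint _)]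
    have : ∫ t in Iic (0 : ℝ), h (t, y) = 0 := by
      apply setIntegral_eq_zero_of_forall_eq_zero
      intro t ht
      apply hz
      intro hm
      have h1 := hm.1.1
      have h2 : t ≤ 0 := ht
      simp only at h1
      linarith
    rw [this, sub_zero]
  rw [hL]
  have : ∀ t, f t * h (x - t, y) = (Iio x).indicator (fun s => h (s, y)) (x - t) := by
    intro t
    by_cases ht : 0 < t
    · rw [hf, indicator_of_mem (show t ∈ Ioi 0 from ht), indicator_of_mem (by simpa using ht)]
      simp
    · rw [hf, indicator_of_notMem (show t ∉ Ioi 0 from ht), indicator_of_notMem (by simpa using ht)]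
      simp
  simp_rw [this]
  rw [integral_sub_left_eq_self (fun s => (Iio x).indicator (fun s => h (s, y)) s),
    integral_indicator measurableSet_Iio, integral_Iic_eq_integral_Iio]

theorem continuous_slice {h : ℝ × ℝ → ℝ} (hh : Continuous h) (y : ℝ) :
    Continuous fun t => h (t, y) := hh.comp (by fun_prop)

theorem hasDerivAt_xPrimitive {h : ℝ × ℝ → ℝ} (hh : Continuous h) (x y : ℝ) :
    HasDerivAt (fun s => xPrimitive h (s, y)) (h (x, y)) x :=
  intervalIntegral.integral_hasDerivAt_right ((continuous_slice hh y).intervalIntegrable _ _)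
    ((continuous_slice hh y).stronglyMeasurableAtFilter _ _) (continuous_slice hh y).continuousAt

theorem partialX_eq_of_hasDerivAt {φ : ℝ × ℝ → ℝ} {x y c : ℝ} (hφ : DifferentiableAt ℝ φ (x, y))
    (hc : HasDerivAt (fun s => φ (s, y)) c x) : partialX φ (x, y) = c := by
  have h1 : HasDerivAt (fun s : ℝ => (s, y)) ((1 : ℝ), (0 : ℝ)) x :=
    (hasDerivAt_id x).prodMk (hasDerivAt_const x y)
  exact (hφ.hasFDerivAt.comp_hasDerivAt (f := fun s : ℝ => (s, y)) x h1).unique hc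

theorem partialY_eq_of_hasDerivAt {φ : ℝ × ℝ → ℝ} {x y c : ℝ} (hφ : DifferentiableAt ℝ φ (x, y))
    (hc : HasDerivAt (fun s => φ (x, s)) c y) : partialY φ (x, y) = c := by
  have h1 : HasDerivAt (fun s : ℝ => (x, s)) ((0 : ℝ), (1 : ℝ)) y :=
    (hasDerivAt_const y x).prodMk (hasDerivAt_id y)
  exact (hφ.hasFDerivAt.comp_hasDerivAt (f := fun s : ℝ => (x, s)) y h1).unique hc

theorem IsTest.partialX_xPrimitive {h : ℝ × ℝ → ℝ} (hh : IsTest h) :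
    partialX (xPrimitive h) = h := by
  ext ⟨x, y⟩
  exact partialX_eq_of_hasDerivAt
    ((hh.contDiff_xPrimitive.differentiable (by simp)) (x, y))
    (hasDerivAt_xPrimitive hh.1.continuous x y)

/-- The primitive of a test function with mean value zero on each horizontal line is again a test
function. -/
theorem IsTest.isTest_xPrimitive {h : ℝ × ℝ → ℝ} (hh : IsTest h)
    (h0 : ∀ y, xMoment 0 h y = 0) : IsTest (xPrimitive h) := by
  have hsm := hh.contDiff_xPrimitive
  obtain ⟨hs, a, ha, hz⟩ := isTest_iff.1 hh
  refine isTest_iff.2 ⟨hsm, a, ha, ?_⟩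
  rintro ⟨x, y⟩ hxy
  simp only [xPrimitive]
  by_cases hy : y ∈ Icc a (1 - a)
  · have hx : x < a ∨ 1 - a < x := by
      by_contra! hcon
      exact hxy ⟨⟨hcon.1, hcon.2⟩, hy⟩
    rcases hx with hx | hx
    · apply intervalIntegral.integral_zero_ae
      refine Filter.Eventually.of_forall fun t ht => hz _ fun hm => ?_
      have h1 : a ≤ t := hm.1.1
      have h2 : t ≤ max 0 x := ht.2
      rcases le_max_iff.1 h2 with h | h <;> linarith
    · have hadd := intervalIntegral.integral_add_adjacent_intervals
        (μ := volume) (f := fun t => h (t, y)) (a := 0) (b := 1) (c := x)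
        ((continuous_slice hs.continuous y).intervalIntegrable _ _)
        ((continuous_slice hs.continuous y).intervalIntegrable _ _)
      rw [← hadd]
      have e1 : ∫ t in (0 : ℝ)..1, h (t, y) = 0 := by simpa [xMoment] using h0 y
      rw [e1, zero_add]
      apply intervalIntegral.integral_zero_ae
      refine Filter.Eventually.of_forall fun t ht => hz _ fun hm => ?_
      have h1 : t ≤ 1 - a := hm.1.2
      have h2 : min 1 x < t := ht.1
      rcases min_lt_iff.1 h2 with h | h <;> linarith
  · apply intervalIntegral.integral_zero_ae
    exact Filter.Eventually.of_forall fun t _ => hz _ fun hm => hy hm.2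

/-- Integration by parts: taking a primitive lowers the order of the moments by one. -/
theorem xMoment_xPrimitive {h : ℝ × ℝ → ℝ} (hh : Continuous h) {y : ℝ} {i : ℕ}
    (h0 : xMoment 0 h y = 0) (hi : xMoment (i + 1) h y = 0) :
    xMoment i (xPrimitive h) y = 0 := by
  have hp : ∀ t : ℝ, HasDerivAt (fun t : ℝ => t ^ (i + 1) / (i + 1)) (t ^ i) t := fun t => by
    have hne : (i : ℝ) + 1 ≠ 0 := by positivity
    refine ((hasDerivAt_pow (i + 1) t).div_const ((i : ℝ) + 1)).congr_deriv ?_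
    push_cast
    field_simp
  have key := intervalIntegral.integral_mul_deriv_eq_deriv_mul (a := 0) (b := 1)
    (u := fun t => xPrimitive h (t, y)) (v := fun t : ℝ => t ^ (i + 1) / (i + 1))
    (u' := fun t => h (t, y)) (v' := fun t => t ^ i)
    (fun t _ => hasDerivAt_xPrimitive hh t y) (fun t _ => hp t)
    ((continuous_slice hh y).intervalIntegrable _ _)
    ((continuous_pow i).intervalIntegrable _ _)
  have e1 : xPrimitive h (1, y) = 0 := by simpa [xMoment, xPrimitive] using h0
  have e2 : ∫ t in (0 : ℝ)..1, h (t, y) * (t ^ (i + 1) / (i + 1)) = 0 := by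
    have : ∀ t : ℝ, h (t, y) * (t ^ (i + 1) / (i + 1)) = (t ^ (i + 1) * h (t, y)) / (i + 1) :=
      fun t => by ring
    simp_rw [this]
    rw [intervalIntegral.integral_div]
    rw [xMoment] at hi
    rw [hi, zero_div]
  rw [e1, e2] at key
  rw [xMoment]
  simp_rw [mul_comm (_ ^ i)]
  rw [key]; simp

/-- A test function whose first `n` moments on horizontal lines vanish is the `n`-th derivative of
a test function. -/
theorem IsTest.iterate_xPrimitive (n : ℕ) : ∀ {h : ℝ × ℝ → ℝ}, IsTest h →
    (∀ i < n, ∀ y, xMoment i h y = 0) →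
    IsTest (xPrimitive^[n] h) ∧ partialX^[n] (xPrimitive^[n] h) = h := by
  induction n with
  | zero => intro h hh _; exact ⟨hh, rfl⟩
  | succ n ih =>
    intro h hh hm
    have h1 := hh.isTest_xPrimitive (hm 0 n.succ_pos)
    obtain ⟨h2, h3⟩ := ih h1 fun i hi y =>
      xMoment_xPrimitive hh.1.continuous (hm 0 n.succ_pos y) (hm (i + 1) (by omega) y)
    rw [Function.iterate_succ_apply]
    refine ⟨h2, ?_⟩
    rw [Function.iterate_succ_apply', h3, hh.partialX_xPrimitive]

theorem IsTest.contDiff_xMoment {h : ℝ × ℝ → ℝ} (hh : IsTest h) (i : ℕ) :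
    ContDiff ℝ ∞ (xMoment i h) := by
  have h1 : IsTest fun z => z.1 ^ i * h z := by
    obtain ⟨hs, a, ha, hz⟩ := isTest_iff.1 hh
    exact isTest_iff.2 ⟨(contDiff_fst.pow i).mul hs, a, ha, fun z hm => by rw [hz z hm, mul_zero]⟩
  exact h1.contDiff_xPrimitive.comp (contDiff_const.prodMk contDiff_id)

/-- Subtracting the moments against a system `η` that is dual to the monomials gives a test
function whose first `n` moments on horizontal lines vanish. -/
theorem IsTest.sub_moments {n : ℕ} {η : Fin n → ℝ → ℝ} {a : ℝ} (ha : 0 < a)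
    (hη : ∀ j, ContDiff ℝ ∞ (η j)) (hη0 : ∀ j, ∀ t ∉ Icc a (1 - a), η j t = 0)
    (hdual : ∀ i j : Fin n, ∫ t in (0 : ℝ)..1, t ^ (i : ℕ) * η j t = if i = j then 1 else 0)
    {ψ : ℝ × ℝ → ℝ} (hψ : IsTest ψ) :
    IsTest (fun z => ψ z - ∑ j : Fin n, η j z.1 * xMoment j ψ z.2) ∧
      ∀ i < n, ∀ y, xMoment i (fun z => ψ z - ∑ j : Fin n, η j z.1 * xMoment j ψ z.2) y = 0 := by
  constructor
  · obtain ⟨hs, b, hb, hz⟩ := isTest_iff.1 hψ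
    refine isTest_iff.2 ⟨?_, min a b, lt_min ha hb, ?_⟩
    · refine hs.sub (ContDiff.sum fun j _ => ?_)
      exact ((hη j).comp contDiff_fst).mul ((hψ.contDiff_xMoment j).comp contDiff_snd)
    · rintro ⟨x, y⟩ hxy
      have hsub : ∀ c, min a b ≤ c → Icc c (1 - c) ⊆ Icc (min a b) (1 - min a b) := fun c hc =>
        Icc_subset_Icc hc (by linarith)
      have ha' := hsub a (min_le_left _ _)
      have hb' := hsub b (min_le_right _ _)
      have e1 : ψ (x, y) = 0 := hz _ fun hm => hxy ⟨hb' hm.1, hb' hm.2⟩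
      rw [e1, zero_sub, neg_eq_zero]
      refine Finset.sum_eq_zero fun j _ => ?_
      by_cases hx : x ∈ Icc a (1 - a)
      · have hy : y ∉ Icc b (1 - b) := fun hm => hxy ⟨ha' hx, hb' hm⟩
        have : xMoment j ψ y = 0 := by
          rw [xMoment]
          apply intervalIntegral.integral_zero_ae
          refine Filter.Eventually.of_forall fun t _ => ?_
          rw [hz _ fun hm => hy hm.2, mul_zero]
        rw [this, mul_zero]
      · rw [hη0 j x hx, zero_mul]
  · intro i hi y
    have hc1 : Continuous fun t : ℝ => t ^ i * ψ (t, y) :=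
      (continuous_pow i).mul (continuous_slice hψ.1.continuous y)
    have hc2 : ∀ j : Fin n, Continuous fun t : ℝ => t ^ i * η j t * xMoment j ψ y := fun j =>
      ((continuous_pow i).mul (hη j).continuous).mul continuous_const
    have : ∀ t : ℝ, t ^ i * (ψ (t, y) - ∑ j : Fin n, η j t * xMoment j ψ y) =
        t ^ i * ψ (t, y) - ∑ j : Fin n, (t ^ i * η j t) * xMoment j ψ y := fun t => by
      rw [mul_sub, Finset.mul_sum]
      simp_rw [mul_assoc]
    rw [xMoment]
    simp_rw [this]
    rw [intervalIntegral.integral_sub (hc1.intervalIntegrable _ _)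
      ((continuous_finsetSum _ fun j _ => hc2 j).intervalIntegrable _ _),
      intervalIntegral.integral_finsetSum fun j _ =>
        (hc2 j).intervalIntegrable _ _]
    simp_rw [intervalIntegral.integral_mul_const]
    have hd := hdual ⟨i, hi⟩
    simp only at hd
    simp_rw [hd]
    simp [xMoment]

/-! ### The square as a product measure -/

/-- Lebesgue measure on the unit interval. -/
noncomputable def unitMeasure : Measure ℝ := (volume : Measure ℝ).restrict (Icc 0 1)

instance : IsProbabilityMeasure unitMeasure := ⟨by simp [unitMeasure]⟩

theorem squareMeasure_eq_prod : squareMeasure = unitMeasure.prod unitMeasure := by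
  rw [squareMeasure, unitMeasure, Measure.prod_restrict]; rfl

instance : IsProbabilityMeasure squareMeasure := by
  rw [squareMeasure_eq_prod]; infer_instance

theorem intervalIntegral_eq_unitMeasure (f : ℝ → ℝ) :
    ∫ t in (0 : ℝ)..1, f t = ∫ t, f t ∂unitMeasure := by
  rw [intervalIntegral.integral_of_le zero_le_one, unitMeasure, integral_Icc_eq_integral_Ioc]

theorem squareMeasure_eq_restrict_openSquare :
    squareMeasure = (volume : Measure (ℝ × ℝ)).restrict openSquare := by
  rw [squareMeasure, openSquare, closedSquare, Measure.volume_eq_prod, ← Measure.prod_restrict,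
    ← Measure.prod_restrict, Measure.restrict_congr_set Ioo_ae_eq_Icc]

theorem ae_mem_openSquare : ∀ᵐ z ∂squareMeasure, z ∈ openSquare := by
  rw [squareMeasure_eq_restrict_openSquare]
  exact ae_restrict_mem (measurableSet_Ioo.prod measurableSet_Ioo)

theorem openSquare_subset_closedSquare : openSquare ⊆ closedSquare :=
  prod_mono Ioo_subset_Icc_self Ioo_subset_Icc_self

theorem ae_mem_closedSquare : ∀ᵐ z ∂squareMeasure, z ∈ closedSquare :=
  ae_mem_openSquare.mono fun _ hz => openSquare_subset_closedSquare hz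

theorem ae_mem_unit : ∀ᵐ t ∂unitMeasure, t ∈ Icc (0 : ℝ) 1 :=
  ae_restrict_mem measurableSet_Icc

theorem setIntegral_openSquare (f : ℝ × ℝ → ℝ) :
    ∫ z in openSquare, f z = ∫ z, f z ∂squareMeasure := by
  rw [squareMeasure_eq_restrict_openSquare]

theorem ae_snd_of_ae {P : ℝ → Prop} (h : ∀ᵐ y ∂unitMeasure, P y) :
    ∀ᵐ z ∂squareMeasure, P z.2 := by
  rw [squareMeasure_eq_prod]
  exact Measure.quasiMeasurePreserving_snd.ae h

theorem ae_ae_of_ae_square {P : ℝ × ℝ → Prop} (h : ∀ᵐ z ∂squareMeasure, P z) :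
    ∀ᵐ y ∂unitMeasure, ∀ᵐ x ∂unitMeasure, P (x, y) := by
  rw [squareMeasure_eq_prod] at h
  have h2 : ∀ᵐ z ∂unitMeasure.prod unitMeasure, P z.swap :=
    Measure.measurePreserving_swap.quasiMeasurePreserving.ae h
  exact Measure.ae_ae_of_ae_prod h2

/-! ### Integral operators in the first variable -/

/-- The involution `((x, y), t) ↦ ((t, y), x)`. -/
def exchange : (ℝ × ℝ) × ℝ ≃ᵐ (ℝ × ℝ) × ℝ :=
  MeasurableEquiv.ofInvolutive (fun w => ((w.2, w.1.2), w.1.1)) (fun _ => rfl) (by fun_prop)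

theorem exchange_apply (w : (ℝ × ℝ) × ℝ) : exchange w = ((w.2, w.1.2), w.1.1) := rfl

theorem measurePreserving_exchange :
    MeasurePreserving exchange (squareMeasure.prod unitMeasure)
      (squareMeasure.prod unitMeasure) := by
  rw [squareMeasure_eq_prod]
  have h1 := measurePreserving_prodAssoc unitMeasure unitMeasure unitMeasure
  have h2 := Measure.measurePreserving_swap (μ := unitMeasure)
    (ν := unitMeasure.prod unitMeasure)
  have h3 := (Measure.measurePreserving_swap (μ := unitMeasure) (ν := unitMeasure)).prod
    (MeasurePreserving.id unitMeasure)
  exact h3.comp (h2.comp h1)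

/-- Measurable kernels that are bounded by `C` on the closed square. -/
def BoundedKernel (K : ℝ → ℝ → ℝ) (C : ℝ) : Prop :=
  Measurable (fun z : ℝ × ℝ => K z.1 z.2) ∧ ∀ x ∈ Icc (0 : ℝ) 1, ∀ t ∈ Icc (0 : ℝ) 1, |K x t| ≤ C

/-- The integral operator with kernel `K` that acts on the first variable. -/
noncomputable def xOperator (K : ℝ → ℝ → ℝ) (f : ℝ × ℝ → ℝ) (z : ℝ × ℝ) : ℝ :=
  ∫ t, K z.1 t * f (t, z.2) ∂unitMeasure

/-- The `L¹` norm of a function on horizontal lines. -/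
noncomputable def rowNorm (f : ℝ × ℝ → ℝ) (y : ℝ) : ℝ := ∫ t, |f (t, y)| ∂unitMeasure

theorem rowNorm_nonneg (f : ℝ × ℝ → ℝ) (y : ℝ) : 0 ≤ rowNorm f y :=
  integral_nonneg fun _ => abs_nonneg _

theorem integrable_kernel_mul {K : ℝ → ℝ → ℝ} {C : ℝ} (hK : BoundedKernel K C)
    {f : ℝ × ℝ → ℝ} (hf : Integrable f squareMeasure) :
    Integrable (fun w : (ℝ × ℝ) × ℝ => K w.1.1 w.2 * f (w.2, w.1.2))
      (squareMeasure.prod unitMeasure) := by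
  -- The integrand is not a function of one factor, but becomes one after exchanging `x` and `t`.
  have h1 : Integrable (fun w : (ℝ × ℝ) × ℝ => f (w.2, w.1.2))
      (squareMeasure.prod unitMeasure) :=
    (measurePreserving_exchange.integrable_comp_emb exchange.measurableEmbedding).2
      (hf.comp_fst unitMeasure)
  refine h1.bdd_mul (c := C) ?_ ?_
  · exact (hK.1.comp (by fun_prop : Measurable fun w : (ℝ × ℝ) × ℝ =>
      (w.1.1, w.2))).aestronglyMeasurable
  · have e1 : ∀ᵐ w ∂squareMeasure.prod unitMeasure, w.1 ∈ closedSquare :=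
      Measure.quasiMeasurePreserving_fst.ae ae_mem_closedSquare
    have e2 : ∀ᵐ w ∂squareMeasure.prod unitMeasure, w.2 ∈ Icc (0 : ℝ) 1 :=
      Measure.quasiMeasurePreserving_snd.ae ae_mem_unit
    filter_upwards [e1, e2] with w h1 h2
    exact hK.2 _ h1.1 _ h2

theorem integrable_xOperator {K : ℝ → ℝ → ℝ} {C : ℝ} (hK : BoundedKernel K C)
    {f : ℝ × ℝ → ℝ} (hf : Integrable f squareMeasure) :
    Integrable (xOperator K f) squareMeasure :=
  (integrable_kernel_mul hK hf).integral_prod_left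

/-- Fubini's theorem: the adjoint of an integral operator has the transposed kernel. -/
theorem integral_xOperator_mul {K : ℝ → ℝ → ℝ} {C : ℝ} (hK : BoundedKernel K C)
    {f : ℝ × ℝ → ℝ} (hf : Integrable f squareMeasure) {ψ : ℝ × ℝ → ℝ} (hψ : Continuous ψ) {D : ℝ}
    (hD : ∀ z, |ψ z| ≤ D) :
    ∫ z, xOperator K f z * ψ z ∂squareMeasure =
      ∫ z, f z * xOperator (fun x t => K t x) ψ z ∂squareMeasure := by
  have hI : Integrable (fun w : (ℝ × ℝ) × ℝ => K w.1.1 w.2 * f (w.2, w.1.2) * ψ w.1)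
      (squareMeasure.prod unitMeasure) :=
    (integrable_kernel_mul hK hf).mul_bdd (c := D)
      (hψ.comp continuous_fst).aestronglyMeasurable
      (Filter.Eventually.of_forall fun w => hD _)
  have hJ : Integrable (fun w : (ℝ × ℝ) × ℝ => f w.1 * (K w.2 w.1.1 * ψ (w.2, w.1.2)))
      (squareMeasure.prod unitMeasure) := by
    rw [← measurePreserving_exchange.integrable_comp_emb exchange.measurableEmbedding]
    refine hI.congr (Filter.Eventually.of_forall fun w => ?_)
    simp only [Function.comp, exchange_apply]
    ring
  have e1 : ∫ z, xOperator K f z * ψ z ∂squareMeasure =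
      ∫ w, K w.1.1 w.2 * f (w.2, w.1.2) * ψ w.1 ∂squareMeasure.prod unitMeasure := by
    rw [integral_prod _ hI]
    simp_rw [integral_mul_const]
    rfl
  have e2 : ∫ z, f z * xOperator (fun x t => K t x) ψ z ∂squareMeasure =
      ∫ w, f w.1 * (K w.2 w.1.1 * ψ (w.2, w.1.2)) ∂squareMeasure.prod unitMeasure := by
    rw [integral_prod _ hJ]
    simp_rw [integral_const_mul]
    rfl
  rw [e1, e2, ← measurePreserving_exchange.integral_comp exchange.measurableEmbedding]
  refine integral_congr_ae (Filter.Eventually.of_forall fun w => ?_)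
  simp only [exchange_apply]
  ring

theorem ae_integrable_row {f : ℝ × ℝ → ℝ} (hf : Integrable f squareMeasure) :
    ∀ᵐ y ∂unitMeasure, Integrable (fun t => f (t, y)) unitMeasure := by
  rw [squareMeasure_eq_prod] at hf
  exact hf.prod_left_ae

theorem abs_xOperator_le {K : ℝ → ℝ → ℝ} {C : ℝ} (hK : BoundedKernel K C)
    {f : ℝ × ℝ → ℝ} (hf : Integrable f squareMeasure) :
    ∀ᵐ z ∂squareMeasure, |xOperator K f z| ≤ C * rowNorm f z.2 := by
  filter_upwards [ae_mem_closedSquare, ae_snd_of_ae (ae_integrable_row hf)] with z hz hint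
  rw [rowNorm, ← integral_const_mul]
  refine norm_integral_le_of_norm_le (f := fun t => K z.1 t * f (t, z.2)) (hint.abs.const_mul C) ?_
  filter_upwards [ae_mem_unit] with t ht
  rw [norm_mul]
  exact mul_le_mul_of_nonneg_right (hK.2 _ hz.1 _ ht) (norm_nonneg _)

theorem rowNorm_le_of_ae_le {f : ℝ × ℝ → ℝ} {c : ℝ → ℝ}
    (h : ∀ᵐ z ∂squareMeasure, |f z| ≤ c z.2) : ∀ᵐ y ∂unitMeasure, rowNorm f y ≤ c y := by
  filter_upwards [ae_ae_of_ae_square h] with y hy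
  have : ∫ _t, c y ∂unitMeasure = c y := by simp
  rw [rowNorm, ← this]
  exact integral_mono_of_nonneg (Filter.Eventually.of_forall fun _ => abs_nonneg _)
    (integrable_const _) hy

/-! ### Recovering a function from its pure weak derivative -/

/-- The kernel of `f ↦ ∫ₓ¹ f(t, y) dt`, the adjoint of the primitive `xPrimitive`. -/
noncomputable def tailKernel (x t : ℝ) : ℝ := if x < t then 1 else 0

theorem boundedKernel_tailKernel : BoundedKernel tailKernel 1 := by
  refine ⟨?_, fun x _ t _ => ?_⟩
  · exact Measurable.ite (measurableSet_lt measurable_fst measurable_snd) measurable_const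
      measurable_const
  · rw [tailKernel]; split_ifs <;> simp

theorem xOperator_tailKernel_transpose (ψ : ℝ × ℝ → ℝ) {z : ℝ × ℝ} (hz : z ∈ closedSquare) :
    xOperator (fun x t => tailKernel t x) ψ z = xPrimitive ψ z := by
  have h1 : ∀ t, tailKernel t z.1 * ψ (t, z.2) =
      (Iio z.1).indicator (fun t => ψ (t, z.2)) t := fun t => by
    by_cases ht : t < z.1 <;> simp [tailKernel, indicator, ht]
  rw [xOperator, xPrimitive]
  simp_rw [h1]
  rw [integral_indicator measurableSet_Iio, unitMeasure,
    Measure.restrict_restrict measurableSet_Iio, intervalIntegral.integral_of_le hz.1.1,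
    integral_Ioc_eq_integral_Ioo, ← integral_Ico_eq_integral_Ioo]
  congr 2
  ext t
  simp only [mem_inter_iff, mem_Iio, mem_Icc, mem_Ico]
  have := hz.1.2
  constructor
  · rintro ⟨a, b, c⟩; exact ⟨b, a⟩
  · rintro ⟨a, b⟩; exact ⟨b, a, by linarith⟩

theorem IsTest.exists_bound {ψ : ℝ × ℝ → ℝ} (hψ : IsTest ψ) : ∃ D, ∀ z, |ψ z| ≤ D :=
  hψ.2.1.exists_bound_of_continuous hψ.1.continuous

theorem integrable_iterate_tail (n : ℕ) : ∀ {f : ℝ × ℝ → ℝ}, Integrable f squareMeasure →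
    Integrable ((xOperator tailKernel)^[n] f) squareMeasure := by
  induction n with
  | zero => exact fun hf => hf
  | succ n ih => exact fun hf => ih (integrable_xOperator boundedKernel_tailKernel hf)

theorem integral_iterate_tail_mul (n : ℕ) : ∀ {f : ℝ × ℝ → ℝ}, Integrable f squareMeasure →
    ∀ {ψ : ℝ × ℝ → ℝ}, (∀ m ≤ n, IsTest (xPrimitive^[m] ψ)) →
    ∫ z, (xOperator tailKernel)^[n] f z * ψ z ∂squareMeasure =
      ∫ z, f z * xPrimitive^[n] ψ z ∂squareMeasure := by
  induction n with
  | zero => exact fun _ _ _ => rfl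
  | succ n ih =>
    intro f hf ψ hψ
    have hn := hψ n n.le_succ
    obtain ⟨D, hD⟩ := hn.exists_bound
    rw [Function.iterate_succ_apply, Function.iterate_succ_apply',
      ih (integrable_xOperator boundedKernel_tailKernel hf) fun m hm => hψ m (hm.trans n.le_succ),
      integral_xOperator_mul boundedKernel_tailKernel hf hn.1.continuous hD]
    refine integral_congr_ae ?_
    filter_upwards [ae_mem_closedSquare] with z hz
    rw [xOperator_tailKernel_transpose _ hz]

theorem rowNorm_iterate_tail (n : ℕ) {f : ℝ × ℝ → ℝ} (hf : Integrable f squareMeasure) :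
    ∀ᵐ y ∂unitMeasure, rowNorm ((xOperator tailKernel)^[n] f) y ≤ rowNorm f y := by
  induction n with
  | zero => exact Filter.Eventually.of_forall fun _ => le_rfl
  | succ n ih =>
    rw [Function.iterate_succ']
    have h := rowNorm_le_of_ae_le (c := fun y => 1 * rowNorm ((xOperator tailKernel)^[n] f) y)
      (abs_xOperator_le boundedKernel_tailKernel (integrable_iterate_tail n hf))
    filter_upwards [h, ih] with y h1 h2
    exact (h1.trans_eq (one_mul _)).trans h2

theorem abs_iterate_tail_le {n : ℕ} (hn : 1 ≤ n) {f : ℝ × ℝ → ℝ}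
    (hf : Integrable f squareMeasure) :
    ∀ᵐ z ∂squareMeasure, |(xOperator tailKernel)^[n] f z| ≤ rowNorm f z.2 := by
  obtain ⟨m, rfl⟩ : ∃ m, n = m + 1 := ⟨n - 1, by omega⟩
  rw [Function.iterate_succ']
  filter_upwards [abs_xOperator_le boundedKernel_tailKernel (integrable_iterate_tail m hf),
    ae_snd_of_ae (rowNorm_iterate_tail m hf)] with z h1 h2
  exact (h1.trans_eq (one_mul _)).trans h2

/-- A system of smooth functions with compact support in the open unit interval that is dual to
the monomials `1, t, …, tⁿ⁻¹`. -/
def IsDualSystem {n : ℕ} (η : Fin n → ℝ → ℝ) : Prop :=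
  (∀ j, ContDiff ℝ ∞ (η j)) ∧ (∃ a : ℝ, 0 < a ∧ ∀ j, ∀ t ∉ Icc a (1 - a), η j t = 0) ∧
    ∀ i j : Fin n, ∫ t in (0 : ℝ)..1, t ^ (i : ℕ) * η j t = if i = j then 1 else 0

/-- The kernel of the projection `f ↦ ∑ⱼ xʲ ∫ ηⱼ(t) f(t, y) dt` onto the polynomials in the first
variable of degree less than `n`. -/
noncomputable def polyKernel {n : ℕ} (η : Fin n → ℝ → ℝ) (x t : ℝ) : ℝ :=
  ∑ j : Fin n, x ^ (j : ℕ) * η j t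

theorem IsDualSystem.exists_boundedKernel {n : ℕ} {η : Fin n → ℝ → ℝ} (hη : IsDualSystem η) :
    ∃ C, 0 ≤ C ∧ BoundedKernel (polyKernel η) C := by
  have hc : Continuous fun z : ℝ × ℝ => polyKernel η z.1 z.2 :=
    continuous_finsetSum _ fun j _ =>
      (continuous_fst.pow _).mul ((hη.1 j).continuous.comp continuous_snd)
  obtain ⟨C, hC⟩ := (isCompact_Icc.prod isCompact_Icc :
    IsCompact (Icc (0 : ℝ) 1 ×ˢ Icc (0 : ℝ) 1)).exists_bound_of_continuousOn hc.continuousOn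
  exact ⟨C, (norm_nonneg _).trans (hC (0, 0) (by simp)), hc.measurable,
    fun x hx t ht => hC (x, t) ⟨hx, ht⟩⟩

theorem integral_sub_polyKernel_mul {n : ℕ} {η : Fin n → ℝ → ℝ} (hη : IsDualSystem η)
    {f : ℝ × ℝ → ℝ} (hf : Integrable f squareMeasure) {ψ : ℝ × ℝ → ℝ} (hψ : IsTest ψ) :
    ∫ z, (f z - xOperator (polyKernel η) f z) * ψ z ∂squareMeasure =
      ∫ z, f z * (ψ z - ∑ j : Fin n, η j z.1 * xMoment j ψ z.2) ∂squareMeasure := by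
  obtain ⟨C, -, hK⟩ := hη.exists_boundedKernel
  obtain ⟨D, hD⟩ := hψ.exists_bound
  obtain ⟨a, ha, hη0⟩ := hη.2.1
  obtain ⟨E, hE⟩ := (hψ.sub_moments ha hη.1 hη0 hη.2.2).1.exists_bound
  have hsm := (hψ.sub_moments ha hη.1 hη0 hη.2.2).1.1.continuous
  have i1 := hf.mul_bdd (c := D) hψ.1.continuous.aestronglyMeasurable
    (Filter.Eventually.of_forall hD)
  have i2 := (integrable_xOperator hK hf).mul_bdd (c := D) hψ.1.continuous.aestronglyMeasurable
    (Filter.Eventually.of_forall hD)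
  have i3 := hf.mul_bdd (c := E) hsm.aestronglyMeasurable (Filter.Eventually.of_forall hE)
  have key : ∀ z, xOperator (fun x t => polyKernel η t x) ψ z =
      ∑ j : Fin n, η j z.1 * xMoment j ψ z.2 := fun z => by
    have : ∀ t, polyKernel η t z.1 * ψ (t, z.2) =
        ∑ j : Fin n, η j z.1 * (t ^ (j : ℕ) * ψ (t, z.2)) := fun t => by
      rw [polyKernel, Finset.sum_mul]
      exact Finset.sum_congr rfl fun j _ => by ring
    rw [xOperator]
    simp_rw [this]
    rw [integral_finsetSum]
    · simp_rw [integral_const_mul, xMoment, intervalIntegral_eq_unitMeasure]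
    · intro j _
      refine Integrable.const_mul ?_ _
      exact Continuous.integrableOn_Icc
        ((continuous_pow _).mul (continuous_slice hψ.1.continuous _))
  have hsplit : ∀ z, (f z - xOperator (polyKernel η) f z) * ψ z =
      f z * ψ z - xOperator (polyKernel η) f z * ψ z := fun z => sub_mul _ _ _
  simp_rw [hsplit]
  rw [integral_sub i1 i2, integral_xOperator_mul hK hf hψ.1.continuous hD]
  simp_rw [key]
  have i4 : Integrable (fun z => f z * ∑ j : Fin n, η j z.1 * xMoment j ψ z.2) squareMeasure := by
    refine (i1.sub i3).congr (Filter.Eventually.of_forall fun z => ?_)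
    simp only [Pi.sub_apply]
    ring
  rw [← integral_sub i1 i4]
  simp_rw [mul_sub]

/-- The defining identity of the `n`-th weak derivative in the first variable. For integrable
functions on the square it is equivalent to `HasWeakDeriv n 0 f g`. -/
def HasXDeriv (n : ℕ) (f g : ℝ × ℝ → ℝ) : Prop :=
  ∀ φ : ℝ × ℝ → ℝ, IsTest φ → ∫ z, f z * partialX^[n] φ z ∂squareMeasure =
    (-1 : ℝ) ^ n * ∫ z, g z * φ z ∂squareMeasure

theorem HasWeakDeriv.hasXDeriv {n : ℕ} {f g : ℝ × ℝ → ℝ} (h : HasWeakDeriv n 0 f g) :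
    HasXDeriv n f g := fun φ hφ => by
  simpa only [setIntegral_openSquare, Function.iterate_zero, id, add_zero] using h.2.2 φ hφ

/-- Up to a polynomial in the first variable, a function is the iterated integral of its pure weak
derivative. The identity is tested against `ψ`; moving the operators to `ψ` turns it into a test
function with vanishing moments, which is an `n`-th derivative of a test function. -/
theorem sub_polyKernel_eq_of_hasXDeriv {n : ℕ} {η : Fin n → ℝ → ℝ} (hη : IsDualSystem η)
    {f g : ℝ × ℝ → ℝ} (hf : Integrable f squareMeasure) (hg : Integrable g squareMeasure)
    (hfg : HasXDeriv n f g) :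
    ∀ᵐ z ∂squareMeasure, f z - xOperator (polyKernel η) f z =
      (-1) ^ n * ((xOperator tailKernel)^[n] g z -
        xOperator (polyKernel η) ((xOperator tailKernel)^[n] g) z) := by
  obtain ⟨C, -, hK⟩ := hη.exists_boundedKernel
  obtain ⟨a, ha, hη0⟩ := hη.2.1
  set G := (xOperator tailKernel)^[n] g with hG
  have hGi : Integrable G squareMeasure := integrable_iterate_tail n hg
  have j1 := hf.sub (integrable_xOperator hK hf)
  have j2 := (hGi.sub (integrable_xOperator hK hGi)).const_mul ((-1 : ℝ) ^ n)
  have hopen : IsOpen openSquare := isOpen_Ioo.prod isOpen_Ioo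
  -- The difference of both sides is orthogonal to every test function.
  have key := hopen.ae_eq_zero_of_integral_contDiff_smul_eq_zero
    (μ := squareMeasure) ((j1.sub j2).locallyIntegrable.locallyIntegrableOn openSquare) (by
      intro ψ h1 h2 h3
      have hψ : IsTest ψ := ⟨h1, h2, h3⟩
      obtain ⟨D, hD⟩ := hψ.exists_bound
      obtain ⟨ht, hm⟩ := hψ.sub_moments ha hη.1 hη0 hη.2.2
      set h : ℝ × ℝ → ℝ := fun z => ψ z - ∑ j : Fin n, η j z.1 * xMoment j ψ z.2 with hh
      have k1 : Integrable (fun z => (f z - xOperator (polyKernel η) f z) * ψ z) squareMeasure :=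
        j1.mul_bdd (c := D) hψ.1.continuous.aestronglyMeasurable
        (Filter.Eventually.of_forall hD)
      have k2 : Integrable (fun z => (G z - xOperator (polyKernel η) G z) * ψ z) squareMeasure :=
        (hGi.sub (integrable_xOperator hK hGi)).mul_bdd (c := D)
          hψ.1.continuous.aestronglyMeasurable (Filter.Eventually.of_forall hD)
      have e0 : ∀ z, ψ z • ((f - xOperator (polyKernel η) f) - fun z => (-1 : ℝ) ^ n *
          (G - xOperator (polyKernel η) G) z) z =
          (f z - xOperator (polyKernel η) f z) * ψ z - (-1 : ℝ) ^ n *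
            ((G z - xOperator (polyKernel η) G z) * ψ z) := fun z => by
        simp only [Pi.sub_apply, smul_eq_mul]; ring
      refine (integral_congr_ae (Filter.Eventually.of_forall e0)).trans ?_
      rw [integral_sub k1 (k2.const_mul _), integral_const_mul]
      have e1 := integral_sub_polyKernel_mul hη hf hψ
      have e2 := integral_sub_polyKernel_mul hη hGi hψ
      rw [e1, e2]
      have e3 := integral_iterate_tail_mul n hg (ψ := h) fun m hmn =>
        (ht.iterate_xPrimitive m fun i hi => hm i (by omega)).1
      obtain ⟨t1, t2⟩ := ht.iterate_xPrimitive n hm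
      have e4 := hfg _ t1
      rw [t2] at e4
      rw [e4, e3, sub_self])
  filter_upwards [key, ae_mem_openSquare] with z h1 h2
  have := h1 h2
  simp only [Pi.sub_apply] at this
  linarith

/-- The one-dimensional error bound for the averaged projection, along horizontal lines. -/
theorem abs_sub_polyKernel_le {n : ℕ} (hn : 1 ≤ n) {η : Fin n → ℝ → ℝ} (hη : IsDualSystem η)
    {C : ℝ} (hC : 0 ≤ C) (hK : BoundedKernel (polyKernel η) C)
    {f g : ℝ × ℝ → ℝ} (hf : Integrable f squareMeasure) (hg : Integrable g squareMeasure)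
    (hfg : HasXDeriv n f g) :
    ∀ᵐ z ∂squareMeasure, |f z - xOperator (polyKernel η) f z| ≤ (1 + C) * rowNorm g z.2 := by
  filter_upwards [sub_polyKernel_eq_of_hasXDeriv hη hf hg hfg, abs_iterate_tail_le hn hg,
    abs_xOperator_le hK (integrable_iterate_tail n hg),
    ae_snd_of_ae (rowNorm_iterate_tail n hg)] with z h1 h2 h3 h4
  rw [h1, abs_mul, abs_pow, abs_neg, abs_one, one_pow, one_mul]
  refine (abs_sub _ _).trans ?_
  have := mul_le_mul_of_nonneg_left h4 hC
  linarith

/-! ### Unisolvence in one variable -/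

/-- Functionals that separate the polynomials of degree less than `n` have an invertible matrix
with respect to the monomials. -/
theorem isUnit_matrix_of_separating {n : ℕ} (L : Fin n → Polynomial ℝ →ₗ[ℝ] ℝ)
    (hL : ∀ f : Polynomial ℝ, f.degree < n → (∀ i, L i f = 0) → f = 0) :
    IsUnit (Matrix.of fun i a : Fin n => L i (Polynomial.X ^ (a : ℕ))) := by
  rw [← Matrix.mulVec_injective_iff_isUnit, ← Matrix.coe_mulVecLin,
    injective_iff_map_eq_zero]
  intro c hc
  have hdeg : (∑ a : Fin n, c a • (Polynomial.X : Polynomial ℝ) ^ (a : ℕ)).degree < n := by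
    rw [← Polynomial.mem_degreeLT]
    refine Submodule.sum_mem _ fun a _ => Submodule.smul_mem _ _ ?_
    rw [Polynomial.mem_degreeLT, Polynomial.degree_X_pow]
    exact_mod_cast a.2
  have h0 := hL _ hdeg fun i => by
    have := congrFun hc i
    simp only [Matrix.mulVecLin_apply, Matrix.mulVec, dotProduct, Matrix.of_apply,
      Pi.zero_apply] at this
    rw [map_sum, ← this]
    refine Finset.sum_congr rfl fun a _ => ?_
    rw [map_smul, smul_eq_mul, mul_comm]
  ext b
  have := congrArg (fun f => Polynomial.coeff f (b : ℕ)) h0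
  simpa [Polynomial.finsetSum_coeff, Polynomial.coeff_X_pow, Fin.val_inj] using this

/-- The functional `f ↦ ∫ ρ(t) tⁱ f(t) dt` on polynomials. -/
noncomputable def weightedMoment {ρ : ℝ → ℝ} (hρ : Continuous ρ) (i : ℕ) :
    Polynomial ℝ →ₗ[ℝ] ℝ where
  toFun f := ∫ t in (0 : ℝ)..1, ρ t * t ^ i * f.eval t
  map_add' f g := by
    simp_rw [Polynomial.eval_add, mul_add]
    exact intervalIntegral.integral_add (Continuous.intervalIntegrable (by fun_prop) _ _)
      (Continuous.intervalIntegrable (by fun_prop) _ _)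
  map_smul' c f := by
    simp_rw [Polynomial.eval_smul, smul_eq_mul, mul_left_comm _ c]
    exact intervalIntegral.integral_const_mul _ _

theorem weightedMoment_apply {ρ : ℝ → ℝ} (hρ : Continuous ρ) (i : ℕ) (f : Polynomial ℝ) :
    weightedMoment hρ i f = ∫ t in (0 : ℝ)..1, ρ t * t ^ i * f.eval t := rfl

theorem integral_mul_eq_zero_of_weightedMoment {ρ : ℝ → ℝ} (hρ : Continuous ρ) {n : ℕ}
    {f r : Polynomial ℝ} (hr : r.degree < n) (h : ∀ i < n, weightedMoment hρ i f = 0) :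
    ∫ t in (0 : ℝ)..1, ρ t * f.eval t * r.eval t = 0 := by
  rcases eq_or_ne r 0 with rfl | hr0
  · simp
  have hnat : r.natDegree < n := (Polynomial.natDegree_lt_iff_degree_lt hr0).2 hr
  have : ∀ t, ρ t * f.eval t * r.eval t =
      ∑ i ∈ Finset.range n, r.coeff i * (ρ t * t ^ i * f.eval t) := fun t => by
    rw [Polynomial.eval_eq_sum_range' hnat t, Finset.mul_sum]
    exact Finset.sum_congr rfl fun i _ => by ring
  simp_rw [this]
  rw [intervalIntegral.integral_finsetSum fun i _ =>
    Continuous.intervalIntegrable (by fun_prop) _ _]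
  refine Finset.sum_eq_zero fun i hi => ?_
  rw [intervalIntegral.integral_const_mul, ← weightedMoment_apply hρ,
    h i (Finset.mem_range.1 hi), mul_zero]

theorem polynomial_eq_zero_of_integral_sq {ρ : ℝ → ℝ} (hρ : Continuous ρ)
    (hnonneg : ∀ t ∈ Icc (0 : ℝ) 1, 0 ≤ ρ t) {a b : ℝ} (ha : 0 ≤ a) (hab : a < b) (hb : b ≤ 1)
    (hpos : ∀ t ∈ Ioo a b, 0 < ρ t) {f : Polynomial ℝ}
    (hf : ∫ t in (0 : ℝ)..1, ρ t * f.eval t * f.eval t = 0) : f = 0 := by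
  refine Polynomial.eq_zero_of_infinite_isRoot f ((Ioo_infinite hab).mono fun t ht => ?_)
  by_contra hne
  have hmul : 0 < ρ t * f.eval t * f.eval t := by
    rw [mul_assoc]
    exact mul_pos (hpos t ht) (mul_self_pos.2 hne)
  refine (intervalIntegral.integral_pos zero_lt_one (Continuous.continuousOn (by fun_prop))
    (fun s hs => ?_) ⟨t, ⟨ha.trans ht.1.le, ht.2.le.trans hb⟩, hmul⟩).ne' hf
  rw [mul_assoc]
  exact mul_nonneg (hnonneg s (Ioc_subset_Icc_self hs)) (mul_self_nonneg _)

/-- The Gram matrix of the monomials `1, t, …, tⁿ⁻¹` for the weight `ρ` on the unit interval. -/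
noncomputable def gramMatrix (ρ : ℝ → ℝ) (n : ℕ) : Matrix (Fin n) (Fin n) ℝ :=
  Matrix.of fun i j => ∫ t in (0 : ℝ)..1, ρ t * t ^ (i : ℕ) * t ^ (j : ℕ)

theorem isUnit_gramMatrix {ρ : ℝ → ℝ} (hρ : Continuous ρ)
    (hnonneg : ∀ t ∈ Icc (0 : ℝ) 1, 0 ≤ ρ t) {a b : ℝ} (ha : 0 ≤ a) (hab : a < b) (hb : b ≤ 1)
    (hpos : ∀ t ∈ Ioo a b, 0 < ρ t) (n : ℕ) : IsUnit (gramMatrix ρ n) := by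
  have := isUnit_matrix_of_separating (n := n) (fun i => weightedMoment hρ i) fun f hf h =>
    polynomial_eq_zero_of_integral_sq hρ hnonneg ha hab hb hpos
      (integral_mul_eq_zero_of_weightedMoment hρ hf fun i hi => h ⟨i, hi⟩)
  simpa [weightedMoment_apply, gramMatrix] using this

/-- Dual systems exist: a Gram matrix with a smooth compactly supported weight is invertible. -/
theorem exists_isDualSystem (n : ℕ) : ∃ η : Fin n → ℝ → ℝ, IsDualSystem η := by
  -- The support of this weight is `[1/6, 5/6]`.
  let ρ : ContDiffBump (1 / 2 : ℝ) := ⟨1 / 4, 1 / 3, by norm_num, by norm_num⟩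
  have hG : IsUnit (gramMatrix ρ n) := by
    refine isUnit_gramMatrix ρ.continuous (fun _ _ => ρ.nonneg) (a := 1 / 4) (b := 3 / 4)
      (by norm_num) (by norm_num) (by norm_num) (fun t ht => ρ.pos_of_mem_ball ?_) n
    rw [Metric.mem_ball, Real.dist_eq, abs_lt]
    change -(1 / 3 : ℝ) < _ ∧ _ < (1 / 3 : ℝ)
    constructor <;> linarith [ht.1, ht.2]
  refine ⟨fun j t => ρ t * ∑ a : Fin n, (gramMatrix ρ n)⁻¹ a j * t ^ (a : ℕ), fun j => ?_,
    ⟨1 / 6, by norm_num, fun j t ht => ?_⟩, fun i j => ?_⟩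
  · exact ρ.contDiff.mul (ContDiff.sum fun a _ => contDiff_const.mul (contDiff_id.pow _))
  · have : ρ t = 0 := by
      apply ρ.zero_of_le_dist
      change (1 / 3 : ℝ) ≤ _
      rw [Real.dist_eq]
      by_contra! hcon
      rw [abs_lt] at hcon
      exact ht ⟨by linarith, by linarith⟩
    exact mul_eq_zero_of_left this _
  · have e : ∀ t : ℝ, t ^ (i : ℕ) * (ρ t * ∑ a : Fin n, (gramMatrix ρ n)⁻¹ a j * t ^ (a : ℕ)) =
        ∑ a : Fin n, ρ t * t ^ (i : ℕ) * t ^ (a : ℕ) * (gramMatrix ρ n)⁻¹ a j := fun t => by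
      rw [Finset.mul_sum, Finset.mul_sum]
      exact Finset.sum_congr rfl fun a _ => by ring
    have hρc : Continuous ρ := ρ.continuous
    simp_rw [e]
    rw [intervalIntegral.integral_finsetSum fun a _ =>
      Continuous.intervalIntegrable (by fun_prop) _ _]
    simp_rw [intervalIntegral.integral_mul_const]
    have hinv := Matrix.mul_nonsing_inv _ ((Matrix.isUnit_iff_isUnit_det _).1 hG)
    have := congrFun (congrFun hinv i) j
    rw [Matrix.mul_apply, Matrix.one_apply] at this
    exact this

/-- The functionals that determine the normal direction of a Raviart–Thomas component: the values
at both endpoints, then the moments. -/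
noncomputable def endpointMoment : ℕ → Polynomial ℝ →ₗ[ℝ] ℝ
  | 0 => Polynomial.leval 0
  | 1 => Polynomial.leval 1
  | i + 2 => weightedMoment (ρ := fun _ => 1) continuous_const i

/-- A polynomial that vanishes at both endpoints is `t (t - 1) r`; its moments against `r` then give
`∫ t (1 - t) r² = 0`. -/
theorem eq_zero_of_endpointMoment {k : ℕ} {f : Polynomial ℝ} (hf : f.degree < (k + 2 : ℕ))
    (h : ∀ i < k + 2, endpointMoment i f = 0) : f = 0 := by
  have h0 : f.eval 0 = 0 := h 0 (by omega)
  have h1 : f.eval 1 = 0 := h 1 (by omega)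
  obtain ⟨g, rfl⟩ := Polynomial.dvd_iff_isRoot.2 h0
  have hg : g.eval 1 = 0 := by simpa using h1
  obtain ⟨r, rfl⟩ := Polynomial.dvd_iff_isRoot.2 hg
  rcases eq_or_ne r 0 with rfl | hr
  · simp
  have hrd : r.degree < k := by
    rw [Polynomial.degree_mul, Polynomial.degree_mul, Polynomial.degree_X_sub_C,
      Polynomial.degree_X_sub_C, Polynomial.degree_eq_natDegree hr] at hf
    rw [Polynomial.degree_eq_natDegree hr]
    norm_cast at hf ⊢
    omega
  have hint := integral_mul_eq_zero_of_weightedMoment (ρ := fun _ => 1) continuous_const hrd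
    fun i hi => h (i + 2) (by omega)
  have hc : Continuous fun t : ℝ => t * (1 - t) := by fun_prop
  have : r = 0 := by
    refine polynomial_eq_zero_of_integral_sq hc
      (fun t ht => mul_nonneg ht.1 (by linarith [ht.2])) le_rfl zero_lt_one le_rfl
      (fun t ht => mul_pos ht.1 (by linarith [ht.2])) ?_
    rw [← neg_eq_zero, ← intervalIntegral.integral_neg, ← hint]
    congr 1
    ext t
    simp
    ring
  exact absurd this hr

/-- The matrix of the functionals `endpointMoment` on the monomials of degree at most `k + 1`. -/
noncomputable def endpointMatrix (k : ℕ) : Matrix (Fin (k + 2)) (Fin (k + 2)) ℝ :=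
  Matrix.of fun i a => endpointMoment i (Polynomial.X ^ (a : ℕ))

theorem isUnit_endpointMatrix (k : ℕ) : IsUnit (endpointMatrix k) :=
  isUnit_matrix_of_separating (fun i => endpointMoment i) fun _ hf h =>
    eq_zero_of_endpointMoment hf fun i hi => h ⟨i, hi⟩

/-! ### Polynomials on the square -/

/-- The polynomial function with a given coefficient matrix. -/
def polyFun {m n : ℕ} (c : Matrix (Fin m) (Fin n) ℝ) (z : ℝ × ℝ) : ℝ :=
  ∑ i : Fin m, ∑ j : Fin n, c i j * (z.1 ^ (i : ℕ) * z.2 ^ (j : ℕ))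

theorem monomial_mem_polyLT {m n i j : ℕ} (hi : i < m) (hj : j < n) :
    (fun z : ℝ × ℝ => z.1 ^ i * z.2 ^ j) ∈ polyLT m n :=
  Submodule.subset_span ⟨i, j, hi, hj, rfl⟩

theorem mem_polyLT_iff {m n : ℕ} {f : ℝ × ℝ → ℝ} :
    f ∈ polyLT m n ↔ ∃ c : Matrix (Fin m) (Fin n) ℝ, f = polyFun c := by
  constructor
  · intro hf
    induction hf using Submodule.span_induction with
    | mem f hf =>
      obtain ⟨i, j, hi, hj, rfl⟩ := hf
      refine ⟨Matrix.single ⟨i, hi⟩ ⟨j, hj⟩ 1, ?_⟩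
      ext z
      rw [polyFun, Finset.sum_eq_single ⟨i, hi⟩, Finset.sum_eq_single ⟨j, hj⟩]
      · simp
      · intro b _ hb
        simp [hb.symm]
      · simp
      · intro a _ ha
        refine Finset.sum_eq_zero fun b _ => ?_
        simp [ha.symm]
      · simp
    | zero => exact ⟨0, by ext z; simp [polyFun]⟩
    | add f g _ _ hf hg =>
      obtain ⟨c, rfl⟩ := hf
      obtain ⟨d, rfl⟩ := hg
      refine ⟨c + d, ?_⟩
      ext z
      simp [polyFun, add_mul, Finset.sum_add_distrib]
    | smul a f _ hf =>
      obtain ⟨c, rfl⟩ := hf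
      refine ⟨a • c, ?_⟩
      ext z
      simp [polyFun, Finset.mul_sum, mul_assoc]
  · rintro ⟨c, rfl⟩
    have : polyFun c = ∑ i : Fin m, ∑ j : Fin n,
        c i j • fun z : ℝ × ℝ => z.1 ^ (i : ℕ) * z.2 ^ (j : ℕ) := by
      ext z
      simp [polyFun, Finset.sum_apply]
    rw [this]
    exact Submodule.sum_mem _ fun i _ => Submodule.sum_mem _ fun j _ =>
      Submodule.smul_mem _ _ (monomial_mem_polyLT i.2 j.2)

theorem polyLT_mono {m n m' n' : ℕ} (hm : m ≤ m') (hn : n ≤ n') : polyLT m n ≤ polyLT m' n' := by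
  refine Submodule.span_mono ?_
  rintro _ ⟨i, j, hi, hj, rfl⟩
  exact ⟨i, j, hi.trans_le hm, hj.trans_le hn, rfl⟩

theorem contDiff_of_mem_polyLT {m n : ℕ} {f : ℝ × ℝ → ℝ} (hf : f ∈ polyLT m n) :
    ContDiff ℝ ∞ f := by
  obtain ⟨c, rfl⟩ := mem_polyLT_iff.1 hf
  exact ContDiff.sum fun i _ => ContDiff.sum fun j _ =>
    contDiff_const.mul ((contDiff_fst.pow _).mul (contDiff_snd.pow _))

theorem comp_swap_mem_polyLT {m n : ℕ} {f : ℝ × ℝ → ℝ} (hf : f ∈ polyLT m n) :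
    (fun z : ℝ × ℝ => f z.swap) ∈ polyLT n m := by
  obtain ⟨c, rfl⟩ := mem_polyLT_iff.1 hf
  refine mem_polyLT_iff.2 ⟨c.transpose, ?_⟩
  ext z
  simp only [polyFun, Prod.fst_swap, Prod.snd_swap, Matrix.transpose_apply]
  rw [Finset.sum_comm]
  simp_rw [mul_comm (z.2 ^ _)]

theorem integrable_of_continuous {f : ℝ × ℝ → ℝ} (hf : Continuous f) :
    Integrable f squareMeasure :=
  hf.continuousOn.integrableOn_compact (isCompact_Icc.prod isCompact_Icc)

/-- Fubini's theorem for products, in the form used for monomials. -/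
theorem integral_square_mul (f g : ℝ → ℝ) :
    ∫ z, f z.1 * g z.2 ∂squareMeasure =
      (∫ t in (0 : ℝ)..1, f t) * ∫ t in (0 : ℝ)..1, g t := by
  rw [squareMeasure_eq_prod, integral_prod_mul, intervalIntegral_eq_unitMeasure,
    intervalIntegral_eq_unitMeasure]

/-- The moments of a polynomial are obtained from the coefficient matrix by applying the Gram
matrix on both sides. -/
theorem integral_polyFun_mul {n : ℕ} (c : Matrix (Fin n) (Fin n) ℝ) (i j : Fin n) :
    ∫ z, polyFun c z * (z.1 ^ (i : ℕ) * z.2 ^ (j : ℕ)) ∂squareMeasure =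
      (gramMatrix (fun _ => 1) n * c * (gramMatrix (fun _ => 1) n).transpose) i j := by
  have : ∀ z : ℝ × ℝ, polyFun c z * (z.1 ^ (i : ℕ) * z.2 ^ (j : ℕ)) =
      ∑ b : Fin n, ∑ a : Fin n, c a b * ((1 * z.1 ^ (i : ℕ) * z.1 ^ (a : ℕ)) *
        (1 * z.2 ^ (j : ℕ) * z.2 ^ (b : ℕ))) := fun z => by
    rw [polyFun, Finset.sum_mul, Finset.sum_comm]
    simp_rw [Finset.sum_mul]
    exact Finset.sum_congr rfl fun _ _ => Finset.sum_congr rfl fun _ _ => by ring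
  simp_rw [this]
  rw [integral_finsetSum _ fun b _ => integrable_of_continuous (by fun_prop)]
  rw [Matrix.mul_apply]
  refine Finset.sum_congr rfl fun b _ => ?_
  rw [integral_finsetSum _ fun a _ => integrable_of_continuous (by fun_prop), Matrix.mul_apply,
    Finset.sum_mul]
  refine Finset.sum_congr rfl fun a _ => ?_
  rw [integral_const_mul, integral_square_mul (fun x => 1 * x ^ (i : ℕ) * x ^ (a : ℕ))
    (fun x => 1 * x ^ (j : ℕ) * x ^ (b : ℕ))]
  simp only [gramMatrix, Matrix.of_apply, Matrix.transpose_apply]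
  ring

theorem isUnit_gramMatrix_one (n : ℕ) : IsUnit (gramMatrix (fun _ => 1) n) :=
  isUnit_gramMatrix continuous_const (fun _ _ => zero_le_one) le_rfl zero_lt_one le_rfl
    (fun _ _ => zero_lt_one) n

/-- The `L²` projection onto `Q_{n-1,n-1}` is bounded from `L¹` to `L^∞`. -/
theorem exists_bound_of_moments (n : ℕ) : ∃ C : ℝ, 0 ≤ C ∧ ∀ r ∈ polyLT n n,
    ∀ g : ℝ × ℝ → ℝ, Integrable g squareMeasure →
    (∀ i j : ℕ, i < n → j < n → ∫ z, r z * (z.1 ^ i * z.2 ^ j) ∂squareMeasure =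
      ∫ z, g z * (z.1 ^ i * z.2 ^ j) ∂squareMeasure) →
    ∀ z ∈ closedSquare, |r z| ≤ C * ∫ z, |g z| ∂squareMeasure := by
  set N := gramMatrix (fun _ => 1) n with hN
  have hdet : IsUnit N.det := (Matrix.isUnit_iff_isUnit_det _).1 (isUnit_gramMatrix_one n)
  refine ⟨∑ a : Fin n, ∑ b : Fin n, ∑ j : Fin n, ∑ i : Fin n, |N⁻¹ a i| * |N⁻¹ b j|,
    by positivity, ?_⟩
  intro r hr g hg hmom z hz
  obtain ⟨c, rfl⟩ := mem_polyLT_iff.1 hr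
  set m : Matrix (Fin n) (Fin n) ℝ :=
    Matrix.of fun i j => ∫ z, g z * (z.1 ^ (i : ℕ) * z.2 ^ (j : ℕ)) ∂squareMeasure with hm
  have hNc : N * c * N.transpose = m := by
    ext i j
    rw [← integral_polyFun_mul, hmom i j i.2 j.2]
    rfl
  have hc : c = N⁻¹ * m * (N⁻¹).transpose := by
    rw [← hNc, Matrix.mul_assoc, Matrix.mul_assoc (N * c), ← Matrix.transpose_mul,
      Matrix.nonsing_inv_mul _ hdet, Matrix.transpose_one, Matrix.mul_one, ← Matrix.mul_assoc,
      Matrix.nonsing_inv_mul _ hdet, Matrix.one_mul]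
  have hpow : ∀ (t : ℝ) (i : ℕ), t ∈ Icc (0 : ℝ) 1 → 0 ≤ t ^ i ∧ t ^ i ≤ 1 := fun t i ht =>
    ⟨pow_nonneg ht.1 i, pow_le_one₀ ht.1 ht.2⟩
  have hmb : ∀ i j, |m i j| ≤ ∫ z, |g z| ∂squareMeasure := fun i j => by
    refine norm_integral_le_of_norm_le (f := fun z => g z * (z.1 ^ (i : ℕ) * z.2 ^ (j : ℕ)))
      hg.abs ?_
    filter_upwards [ae_mem_closedSquare] with w hw
    obtain ⟨h1, h2⟩ := hpow w.1 i hw.1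
    obtain ⟨h3, h4⟩ := hpow w.2 j hw.2
    rw [Real.norm_eq_abs, abs_mul, abs_of_nonneg (mul_nonneg h1 h3)]
    exact mul_le_of_le_one_right (abs_nonneg _) (mul_le_one₀ h2 h3 h4)
  rw [polyFun, Finset.sum_mul]
  refine (Finset.abs_sum_le_sum_abs _ _).trans (Finset.sum_le_sum fun a _ => ?_)
  rw [Finset.sum_mul]
  refine (Finset.abs_sum_le_sum_abs _ _).trans (Finset.sum_le_sum fun b _ => ?_)
  obtain ⟨h1, h2⟩ := hpow z.1 a hz.1
  obtain ⟨h3, h4⟩ := hpow z.2 b hz.2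
  rw [abs_mul, abs_of_nonneg (mul_nonneg h1 h3)]
  refine (mul_le_of_le_one_right (abs_nonneg _) (mul_le_one₀ h2 h3 h4)).trans ?_
  rw [hc, Matrix.mul_apply, Finset.sum_mul]
  refine (Finset.abs_sum_le_sum_abs _ _).trans (Finset.sum_le_sum fun j _ => ?_)
  rw [Matrix.mul_apply, Finset.sum_mul, Finset.sum_mul]
  refine (Finset.abs_sum_le_sum_abs _ _).trans (Finset.sum_le_sum fun i _ => ?_)
  rw [Matrix.transpose_apply, abs_mul, abs_mul]
  have := mul_le_mul_of_nonneg_left (hmb i j)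
    (mul_nonneg (abs_nonneg (N⁻¹ a i)) (abs_nonneg (N⁻¹ b j)))
  linarith

/-! ### The Raviart–Thomas interpolant -/

theorem isCompact_closedSquare : IsCompact closedSquare := isCompact_Icc.prod isCompact_Icc

theorem normalComp_sub (w v : ℝ × ℝ → ℝ × ℝ) (F : Face) (t : ℝ) :
    normalComp (fun z => w z - v z) F t = normalComp w F t - normalComp v F t := by
  simp only [normalComp, dot, Prod.fst_sub, Prod.snd_sub]
  ring

theorem MemRT.contDiff {k : ℕ} {w : ℝ × ℝ → ℝ × ℝ} (hw : MemRT k w) : ContDiff ℝ ∞ w :=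
  (contDiff_of_mem_polyLT hw.1).prodMk (contDiff_of_mem_polyLT hw.2)

theorem MemRT.hasMoments {k : ℕ} {w : ℝ × ℝ → ℝ × ℝ} (hw : MemRT k w) : HasMoments w :=
  hasMoments_of_continuousOn hw.contDiff.continuous.continuousOn

theorem HasMoments.integrable_fst {v : ℝ × ℝ → ℝ × ℝ} (hv : HasMoments v) :
    Integrable (fun z => (v z).1) squareMeasure := hv.1.fst

theorem HasMoments.integrable_snd {v : ℝ × ℝ → ℝ × ℝ} (hv : HasMoments v) :
    Integrable (fun z => (v z).2) squareMeasure := hv.1.snd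

theorem integrable_mul_continuous {f g : ℝ × ℝ → ℝ} (hf : Integrable f squareMeasure)
    (hg : Continuous g) : Integrable (fun z => f z * g z) squareMeasure :=
  IntegrableOn.mul_continuousOn hf hg.continuousOn isCompact_closedSquare

theorem integral_mul_eval_eq_zero_iff {f : ℝ → ℝ} (hf : IntervalIntegrable f volume 0 1) {k : ℕ} :
    (∀ q : Polynomial ℝ, q.natDegree ≤ k → ∫ t in (0 : ℝ)..1, f t * q.eval t = 0) ↔
      ∀ j < k + 1, ∫ t in (0 : ℝ)..1, f t * t ^ j = 0 := by
  constructor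
  · intro h j hj
    have := h (Polynomial.X ^ j) (by rw [Polynomial.natDegree_X_pow]; omega)
    simpa using this
  · intro h q hq
    have : ∀ t, f t * q.eval t = ∑ i ∈ Finset.range (k + 1), q.coeff i * (f t * t ^ i) :=
      fun t => by
      rw [Polynomial.eval_eq_sum_range' (Nat.lt_succ_of_le hq) t, Finset.mul_sum]
      exact Finset.sum_congr rfl fun i _ => by ring
    simp_rw [this]
    rw [intervalIntegral.integral_finsetSum fun i _ =>
      (hf.mul_continuousOn (continuous_pow i).continuousOn).const_mul _]
    refine Finset.sum_eq_zero fun i hi => ?_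
    rw [intervalIntegral.integral_const_mul, h i (Finset.mem_range.1 hi), mul_zero]

theorem integral_mul_polyLT_eq_zero {f : ℝ × ℝ → ℝ} (hf : Integrable f squareMeasure) {m n : ℕ}
    (h : ∀ i j, i < m → j < n → ∫ z, f z * (z.1 ^ i * z.2 ^ j) ∂squareMeasure = 0)
    {q : ℝ × ℝ → ℝ} (hq : q ∈ polyLT m n) : ∫ z, f z * q z ∂squareMeasure = 0 := by
  induction hq using Submodule.span_induction with
  | mem q hq =>
    obtain ⟨i, j, hi, hj, rfl⟩ := hq
    exact h i j hi hj
  | zero => simp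
  | add q r hq hr ihq ihr =>
    simp only [Pi.add_apply, mul_add]
    rw [integral_add (integrable_mul_continuous hf (contDiff_of_mem_polyLT hq).continuous)
      (integrable_mul_continuous hf (contDiff_of_mem_polyLT hr).continuous), ihq, ihr, add_zero]
  | smul a q _ ih =>
    simp only [Pi.smul_apply, smul_eq_mul, mul_left_comm _ a]
    rw [integral_const_mul, ih, mul_zero]

/-- It suffices to test with monomials. -/
theorem isRTInterpolant_iff {k : ℕ} {v w : ℝ × ℝ → ℝ × ℝ} (hv : HasMoments v) :
    IsRTInterpolant k v w ↔ MemRT k w ∧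
      (∀ F : Face, ∀ j < k + 1, ∫ t in (0 : ℝ)..1, normalComp w F t * t ^ j =
        ∫ t in (0 : ℝ)..1, normalComp v F t * t ^ j) ∧
      (∀ i j, i < k → j < k + 1 → ∫ z, (w z).1 * (z.1 ^ i * z.2 ^ j) ∂squareMeasure =
        ∫ z, (v z).1 * (z.1 ^ i * z.2 ^ j) ∂squareMeasure) ∧
      ∀ i j, i < k + 1 → j < k → ∫ z, (w z).2 * (z.1 ^ i * z.2 ^ j) ∂squareMeasure =
        ∫ z, (v z).2 * (z.1 ^ i * z.2 ^ j) ∂squareMeasure := by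
  rw [IsRTInterpolant]
  refine and_congr_right fun hRT => ?_
  have hw := hRT.hasMoments
  refine and_congr ?_ ?_
  · refine forall_congr' fun F => ?_
    simp_rw [normalComp_sub]
    rw [integral_mul_eval_eq_zero_iff ((hw.2 F).sub (hv.2 F))]
    refine forall_congr' fun j => imp_congr_right fun _ => ?_
    simp_rw [sub_mul]
    rw [intervalIntegral.integral_sub
      ((hw.2 F).mul_continuousOn (continuous_pow j).continuousOn)
      ((hv.2 F).mul_continuousOn (continuous_pow j).continuousOn), sub_eq_zero]
  · have hm : ∀ i j : ℕ, Continuous fun z : ℝ × ℝ => z.1 ^ i * z.2 ^ j := fun i j => by fun_prop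
    have d1 : Integrable (fun z => (w z).1 - (v z).1) squareMeasure :=
      hw.integrable_fst.sub hv.integrable_fst
    have d2 : Integrable (fun z => (w z).2 - (v z).2) squareMeasure :=
      hw.integrable_snd.sub hv.integrable_snd
    have s1 : ∀ i j : ℕ, ∫ z, ((w z).1 - (v z).1) * (z.1 ^ i * z.2 ^ j) ∂squareMeasure = 0 ↔
        ∫ z, (w z).1 * (z.1 ^ i * z.2 ^ j) ∂squareMeasure =
        ∫ z, (v z).1 * (z.1 ^ i * z.2 ^ j) ∂squareMeasure := fun i j => by
      simp_rw [sub_mul]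
      rw [integral_sub (integrable_mul_continuous hw.integrable_fst (hm i j))
        (integrable_mul_continuous hv.integrable_fst (hm i j)), sub_eq_zero]
    have s2 : ∀ i j : ℕ, ∫ z, ((w z).2 - (v z).2) * (z.1 ^ i * z.2 ^ j) ∂squareMeasure = 0 ↔
        ∫ z, (w z).2 * (z.1 ^ i * z.2 ^ j) ∂squareMeasure =
        ∫ z, (v z).2 * (z.1 ^ i * z.2 ^ j) ∂squareMeasure := fun i j => by
      simp_rw [sub_mul]
      rw [integral_sub (integrable_mul_continuous hw.integrable_snd (hm i j))
        (integrable_mul_continuous hv.integrable_snd (hm i j)), sub_eq_zero]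
    constructor
    · intro h
      constructor
      · intro i j hi hj
        have := h (fun z => (z.1 ^ i * z.2 ^ j, 0))
          ⟨monomial_mem_polyLT hi hj, Submodule.zero_mem _⟩
        rw [← s1]
        simpa [dot, squareMeasure] using this
      · intro i j hi hj
        have := h (fun z => (0, z.1 ^ i * z.2 ^ j))
          ⟨Submodule.zero_mem _, monomial_mem_polyLT hi hj⟩
        rw [← s2]
        simpa [dot, squareMeasure] using this
    · rintro ⟨h1, h2⟩ q ⟨hq1, hq2⟩
      have e1 := integral_mul_polyLT_eq_zero d1 (fun i j hi hj => (s1 i j).2 (h1 i j hi hj)) hq1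
      have e2 := integral_mul_polyLT_eq_zero d2 (fun i j hi hj => (s2 i j).2 (h2 i j hi hj)) hq2
      change ∫ z, (((w z).1 - (v z).1) * (q z).1 + ((w z).2 - (v z).2) * (q z).2)
        ∂squareMeasure = 0
      rw [integral_add (integrable_mul_continuous d1 (contDiff_of_mem_polyLT hq1).continuous)
        (integrable_mul_continuous d2 (contDiff_of_mem_polyLT hq2).continuous)]
      exact (congrArg₂ (· + ·) e1 e2).trans (add_zero 0)

/-- The degrees of freedom of the first component of a Raviart–Thomas field: the moments on the
left and right faces, then the interior moments. -/
noncomputable def compMoment : ℕ → ℕ → (ℝ × ℝ → ℝ) → ℝ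
  | 0, j, f => ∫ t in (0 : ℝ)..1, f (0, t) * t ^ j
  | 1, j, f => ∫ t in (0 : ℝ)..1, f (1, t) * t ^ j
  | i + 2, j, f => ∫ z, f z * (z.1 ^ i * z.2 ^ j) ∂squareMeasure

/-- The degrees of freedom of both components; the second one is reflected at the diagonal. -/
theorem isRTInterpolant_iff_compMoment {k : ℕ} {v w : ℝ × ℝ → ℝ × ℝ} (hv : HasMoments v) :
    IsRTInterpolant k v w ↔
      ((fun z => (w z).1) ∈ polyLT (k + 2) (k + 1) ∧ ∀ i < k + 2, ∀ j < k + 1,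
        compMoment i j (fun z => (w z).1) = compMoment i j (fun z => (v z).1)) ∧
      ((fun z : ℝ × ℝ => (w z.swap).2) ∈ polyLT (k + 2) (k + 1) ∧ ∀ i < k + 2, ∀ j < k + 1,
        compMoment i j (fun z => (w z.swap).2) = compMoment i j (fun z => (v z.swap).2)) := by
  have hswap : ∀ (f : ℝ × ℝ → ℝ) (i j : ℕ),
      ∫ z, f z.swap * (z.1 ^ i * z.2 ^ j) ∂squareMeasure =
        ∫ z, f z * (z.1 ^ j * z.2 ^ i) ∂squareMeasure := fun f i j => by
    rw [squareMeasure_eq_prod, ← integral_prod_swap]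
    refine integral_congr_ae (Filter.Eventually.of_forall fun z => ?_)
    simp only [Prod.swap_swap, Prod.fst_swap, Prod.snd_swap, mul_comm (z.2 ^ i)]
  rw [isRTInterpolant_iff hv]
  constructor
  · rintro ⟨⟨m1, m2⟩, hF, h1, h2⟩
    refine ⟨⟨m1, ?_⟩, comp_swap_mem_polyLT m2, ?_⟩
    · rintro (_ | _ | i) hi j hj
      · simpa [normalComp, dot, Face.param, Face.normal, compMoment,
          intervalIntegral.integral_neg] using hF .left j hj
      · simpa [normalComp, dot, Face.param, Face.normal, compMoment] using hF .right j hj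
      · exact h1 i j (by omega) hj
    · rintro (_ | _ | i) hi j hj
      · simpa [normalComp, dot, Face.param, Face.normal, compMoment,
          intervalIntegral.integral_neg] using hF .bottom j hj
      · simpa [normalComp, dot, Face.param, Face.normal, compMoment] using hF .top j hj
      · simp only [compMoment]
        rw [hswap fun z => (w z).2, hswap fun z => (v z).2]
        exact h2 j i hj (by omega)
  · rintro ⟨⟨m1, h1⟩, m2, h2⟩
    refine ⟨⟨m1, comp_swap_mem_polyLT m2⟩, ?_, fun i j hi hj => h1 (i + 2) (by omega) j hj, ?_⟩
    · rintro (_ | _ | _ | _) j hj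
      · simpa [normalComp, dot, Face.param, Face.normal, compMoment,
          intervalIntegral.integral_neg] using h1 0 (by omega) j hj
      · simpa [normalComp, dot, Face.param, Face.normal, compMoment] using h1 1 (by omega) j hj
      · simpa [normalComp, dot, Face.param, Face.normal, compMoment,
          intervalIntegral.integral_neg] using h2 0 (by omega) j hj
      · simpa [normalComp, dot, Face.param, Face.normal, compMoment] using h2 1 (by omega) j hj
    · intro i j hi hj
      have := h2 (j + 2) (by omega) i hi
      simp only [compMoment] at this
      rwa [hswap fun z => (w z).2, hswap fun z => (v z).2] at this

theorem compMoment_polyFun {k : ℕ} (c : Matrix (Fin (k + 2)) (Fin (k + 1)) ℝ) (i : Fin (k + 2))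
    (j : Fin (k + 1)) :
    compMoment i j (polyFun c) =
      (endpointMatrix k * c * (gramMatrix (fun _ => 1) (k + 1)).transpose) i j := by
  have hface : ∀ x : ℝ, ∫ t in (0 : ℝ)..1, polyFun c (x, t) * t ^ (j : ℕ) =
      ∑ b : Fin (k + 1), (∑ a : Fin (k + 2), x ^ (a : ℕ) * c a b) *
        ∫ t in (0 : ℝ)..1, 1 * t ^ (j : ℕ) * t ^ (b : ℕ) := fun x => by
    have : ∀ t : ℝ, polyFun c (x, t) * t ^ (j : ℕ) = ∑ b : Fin (k + 1),
        (∑ a : Fin (k + 2), x ^ (a : ℕ) * c a b) * (1 * t ^ (j : ℕ) * t ^ (b : ℕ)) := fun t => by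
      rw [polyFun, Finset.sum_comm, Finset.sum_mul]
      simp_rw [Finset.sum_mul]
      exact Finset.sum_congr rfl fun _ _ => Finset.sum_congr rfl fun _ _ => by ring
    simp_rw [this]
    rw [intervalIntegral.integral_finsetSum fun b _ =>
      Continuous.intervalIntegrable (by fun_prop) _ _]
    simp_rw [intervalIntegral.integral_const_mul]
  simp only [Matrix.mul_apply, Matrix.transpose_apply, endpointMatrix, Matrix.of_apply, gramMatrix]
  obtain ⟨_ | _ | i, hi⟩ := i
  · simp only [compMoment, endpointMoment]
    rw [hface]
    simp [Polynomial.leval_apply]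
  · simp only [compMoment, endpointMoment]
    rw [hface]
    simp [Polynomial.leval_apply]
  · simp only [compMoment, endpointMoment, weightedMoment_apply, Polynomial.eval_pow,
      Polynomial.eval_X]
    have : ∀ z : ℝ × ℝ, polyFun c z * (z.1 ^ i * z.2 ^ (j : ℕ)) =
        ∑ b : Fin (k + 1), ∑ a : Fin (k + 2), c a b * ((1 * z.1 ^ i * z.1 ^ (a : ℕ)) *
          (1 * z.2 ^ (j : ℕ) * z.2 ^ (b : ℕ))) := fun z => by
      rw [polyFun, Finset.sum_mul, Finset.sum_comm]
      simp_rw [Finset.sum_mul]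
      exact Finset.sum_congr rfl fun _ _ => Finset.sum_congr rfl fun _ _ => by ring
    simp_rw [this]
    rw [integral_finsetSum _ fun b _ => integrable_of_continuous (by fun_prop)]
    refine Finset.sum_congr rfl fun b _ => ?_
    rw [integral_finsetSum _ fun a _ => integrable_of_continuous (by fun_prop), Finset.sum_mul]
    refine Finset.sum_congr rfl fun a _ => ?_
    rw [integral_const_mul, integral_square_mul (fun x => 1 * x ^ i * x ^ (a : ℕ))
      (fun x => 1 * x ^ (j : ℕ) * x ^ (b : ℕ))]
    ring

/-- Unisolvence of one component: the matrix of the degrees of freedom is a tensor product of the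
invertible one-dimensional matrices. -/
theorem existsUnique_compMoment (k : ℕ) (b : ℕ → ℕ → ℝ) :
    ∃! g : ℝ × ℝ → ℝ, g ∈ polyLT (k + 2) (k + 1) ∧
      ∀ i < k + 2, ∀ j < k + 1, compMoment i j g = b i j := by
  set E := endpointMatrix k with hE
  set N := gramMatrix (fun _ => 1) (k + 1) with hN
  have hEd : IsUnit E.det := (Matrix.isUnit_iff_isUnit_det _).1 (isUnit_endpointMatrix k)
  have hNd : IsUnit N.transpose.det := by
    rw [Matrix.det_transpose]
    exact (Matrix.isUnit_iff_isUnit_det _).1 (isUnit_gramMatrix_one (k + 1))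
  set B : Matrix (Fin (k + 2)) (Fin (k + 1)) ℝ := Matrix.of fun i j => b i j with hB
  refine ⟨polyFun (E⁻¹ * B * N.transpose⁻¹), ⟨mem_polyLT_iff.2 ⟨_, rfl⟩, fun i hi j hj => ?_⟩, ?_⟩
  · rw [compMoment_polyFun _ ⟨i, hi⟩ ⟨j, hj⟩, Matrix.mul_assoc, Matrix.mul_assoc,
      Matrix.nonsing_inv_mul _ hNd, Matrix.mul_one, Matrix.mul_nonsing_inv_cancel_left _ _ hEd]
    rfl
  · rintro g ⟨hg, hm⟩
    obtain ⟨c, rfl⟩ := mem_polyLT_iff.1 hg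
    have : E * c * N.transpose = B := by
      ext i j
      rw [← compMoment_polyFun]
      exact hm i i.2 j j.2
    rw [← this, Matrix.mul_assoc, Matrix.mul_assoc, Matrix.mul_assoc,
      Matrix.mul_nonsing_inv _ hNd, Matrix.mul_one, Matrix.nonsing_inv_mul_cancel_left _ _ hEd]

theorem existsUnique_isRTInterpolant (k : ℕ) {v : ℝ × ℝ → ℝ × ℝ} (hv : HasMoments v) :
    ∃! w : ℝ × ℝ → ℝ × ℝ, IsRTInterpolant k v w := by
  obtain ⟨g, hg, hgu⟩ := existsUnique_compMoment k fun i j => compMoment i j fun z => (v z).1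
  obtain ⟨h, hh, hhu⟩ := existsUnique_compMoment k fun i j => compMoment i j fun z => (v z.swap).2
  refine ⟨fun z => (g z, h z.swap), (isRTInterpolant_iff_compMoment hv).2 ⟨hg, ?_⟩, ?_⟩
  · simpa only [Prod.swap_swap] using hh
  · intro w hw
    obtain ⟨h1, h2⟩ := (isRTInterpolant_iff_compMoment hv).1 hw
    ext z
    · exact congrFun (hgu _ h1) z
    · simpa using congrFun (hhu _ h2) z.swap

/-! ### Green's formula -/

/-- The classical divergence. -/
noncomputable def divergence (w : ℝ × ℝ → ℝ × ℝ) (z : ℝ × ℝ) : ℝ :=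
  partialX (fun z => (w z).1) z + partialY (fun z => (w z).2) z

theorem continuous_partialX {f : ℝ × ℝ → ℝ} (hf : ContDiff ℝ ∞ f) : Continuous (partialX f) :=
  (hf.continuous_fderiv (by simp)).clm_apply continuous_const

theorem continuous_partialY {f : ℝ × ℝ → ℝ} (hf : ContDiff ℝ ∞ f) : Continuous (partialY f) :=
  (hf.continuous_fderiv (by simp)).clm_apply continuous_const

theorem partialX_mul {f g : ℝ × ℝ → ℝ} {z : ℝ × ℝ} (hf : DifferentiableAt ℝ f z)
    (hg : DifferentiableAt ℝ g z) :
    partialX (fun z => f z * g z) z = f z * partialX g z + partialX f z * g z := by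
  simp only [partialX]
  rw [fderiv_fun_mul hf hg]
  simp [mul_comm]

theorem partialY_mul {f g : ℝ × ℝ → ℝ} {z : ℝ × ℝ} (hf : DifferentiableAt ℝ f z)
    (hg : DifferentiableAt ℝ g z) :
    partialY (fun z => f z * g z) z = f z * partialY g z + partialY f z * g z := by
  simp only [partialY]
  rw [fderiv_fun_mul hf hg]
  simp [mul_comm]

theorem hasNormalTrace_of_contDiff {w : ℝ × ℝ → ℝ × ℝ} (hw : ContDiff ℝ ∞ w) :
    HasNormalTrace w (divergence w) := by
  intro φ hφ
  have h1 : ContDiff ℝ ∞ fun z => (w z).1 := hw.fst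
  have h2 : ContDiff ℝ ∞ fun z => (w z).2 := hw.snd
  have f1 : ContDiff ℝ ∞ fun z => (w z).1 * φ z := h1.mul hφ
  have f2 : ContDiff ℝ ∞ fun z => (w z).2 * φ z := h2.mul hφ
  have hd : ∀ {f : ℝ × ℝ → ℝ}, ContDiff ℝ ∞ f → ∀ z, DifferentiableAt ℝ f z := fun hf z =>
    hf.differentiable (by simp) z
  have hg : ∀ z : ℝ × ℝ, dot (w z) (grad φ z) + divergence w z * φ z =
      fderiv ℝ (fun z => (w z).1 * φ z) z (1, 0) +
        fderiv ℝ (fun z => (w z).2 * φ z) z (0, 1) := fun z => by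
    have e1 := partialX_mul (hd h1 z) (hd hφ z)
    have e2 := partialY_mul (hd h2 z) (hd hφ z)
    rw [partialX] at e1
    rw [partialY] at e2
    rw [e1, e2]
    simp only [dot, grad, divergence]
    ring
  have key := integral_divergence_prod_Icc_of_hasFDerivAt_of_le (fun z => (w z).1 * φ z)
    (fun z => (w z).2 * φ z) _ _ (0 : ℝ × ℝ) (1 : ℝ × ℝ) zero_le_one f1.continuous.continuousOn
    f2.continuous.continuousOn (fun z _ => (hd f1 z).hasFDerivAt)
    (fun z _ => (hd f2 z).hasFDerivAt)
    (((continuous_partialX f1).add (continuous_partialY f2)).continuousOn.integrableOn_compact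
      isCompact_Icc)
  have hsq : Icc (0 : ℝ × ℝ) 1 = closedSquare := by
    rw [closedSquare, Icc_prod_Icc]; rfl
  rw [hsq] at key
  simp_rw [← hg] at key
  have c1 : Continuous fun z => dot (w z) (grad φ z) :=
    (h1.continuous.mul (continuous_partialX hφ)).add (h2.continuous.mul (continuous_partialY hφ))
  have c2 : Continuous fun z => divergence w z * φ z :=
    ((continuous_partialX h1).add (continuous_partialY h2)).mul hφ.continuous
  rw [integral_add (c1.continuousOn.integrableOn_compact isCompact_closedSquare)
    (c2.continuousOn.integrableOn_compact isCompact_closedSquare)] at key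
  rw [key]
  simp only [normalComp, dot, Face.param, Face.normal, Prod.fst_zero, Prod.snd_zero, Prod.fst_one,
    Prod.snd_one, mul_neg, mul_one, mul_zero, add_zero, zero_add, neg_mul,
    intervalIntegral.integral_neg]
  ring

/-- For test functions the boundary terms in Green's formula vanish. -/
theorem HasNormalTrace.hasWeakDiv {u : ℝ × ℝ → ℝ × ℝ} {d : ℝ × ℝ → ℝ} (h : HasNormalTrace u d)
    (hu : IntegrableOn u closedSquare volume) (hd : Integrable d squareMeasure) :
    HasWeakDiv u d := by
  refine ⟨(hu.mono_set openSquare_subset_closedSquare).locallyIntegrableOn,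
    (IntegrableOn.mono_set hd openSquare_subset_closedSquare).locallyIntegrableOn,
    fun φ hφ => ?_⟩
  obtain ⟨_, a, ha, hz⟩ := isTest_iff.1 hφ
  have h0 : ∀ (F : Face) (t : ℝ), φ (F.param t) = 0 := by
    intro F t
    refine hz _ fun hm => ?_
    simp only [mem_prod, mem_Icc] at hm
    cases F <;> simp only [Face.param] at hm <;> linarith [hm.1.1, hm.1.2, hm.2.1, hm.2.2]
  have key := h φ hφ.1
  simp only [h0, mul_zero, intervalIntegral.integral_zero, add_zero] at key
  rw [setIntegral_openSquare, setIntegral_openSquare]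
  exact eq_neg_of_add_eq_zero_left key

/-! ### The normal trace of a continuous field -/

/-- A smooth cutoff function on the unit interval: for `n ≥ 4` it vanishes within distance `1 / n`
of the endpoints and equals `1` at distance at least `2 / n` from them. -/
noncomputable def cutoff (n : ℕ) (x : ℝ) : ℝ :=
  Real.smoothTransition (n * x - 1) + Real.smoothTransition (n * (1 - x) - 1) - 1

/-- The derivative of `cutoff`. -/
noncomputable def cutoffDeriv (n : ℕ) (x : ℝ) : ℝ :=
  n * deriv Real.smoothTransition (n * x - 1) - n * deriv Real.smoothTransition (n * (1 - x) - 1)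

theorem contDiff_smoothTransition : ContDiff ℝ ∞ Real.smoothTransition :=
  Real.smoothTransition.contDiff (n := ⊤)

theorem continuous_deriv_smoothTransition : Continuous (deriv Real.smoothTransition) :=
  contDiff_smoothTransition.continuous_deriv (by simp)

theorem contDiff_cutoff (n : ℕ) : ContDiff ℝ ∞ (cutoff n) :=
  ((contDiff_smoothTransition.comp ((contDiff_const.mul contDiff_id).sub contDiff_const)).add
    (contDiff_smoothTransition.comp
      ((contDiff_const.mul (contDiff_const.sub contDiff_id)).sub contDiff_const))).sub
    contDiff_const

theorem hasDerivAt_smoothTransition (x : ℝ) :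
    HasDerivAt Real.smoothTransition (deriv Real.smoothTransition x) x :=
  (contDiff_smoothTransition.differentiable (by simp) x).hasDerivAt

theorem hasDerivAt_cutoff (n : ℕ) (x : ℝ) : HasDerivAt (cutoff n) (cutoffDeriv n x) x := by
  have h1 : HasDerivAt (fun x : ℝ => n * x - 1) (n : ℝ) x := by
    simpa using ((hasDerivAt_id x).const_mul (n : ℝ)).sub_const 1
  have h2 : HasDerivAt (fun x : ℝ => n * (1 - x) - 1) (-(n : ℝ)) x := by
    simpa using (((hasDerivAt_id x).const_sub 1).const_mul (n : ℝ)).sub_const 1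
  refine ((((hasDerivAt_smoothTransition _).comp x h1).add
    ((hasDerivAt_smoothTransition _).comp x h2)).sub_const 1).congr_deriv ?_
  rw [cutoffDeriv]; ring

theorem continuous_cutoffDeriv (n : ℕ) : Continuous (cutoffDeriv n) := by
  have := continuous_deriv_smoothTransition
  unfold cutoffDeriv
  fun_prop

theorem abs_cutoff_le (n : ℕ) (x : ℝ) : |cutoff n x| ≤ 1 := by
  rw [cutoff, abs_le]
  have h1 := Real.smoothTransition.nonneg (n * x - 1)
  have h2 := Real.smoothTransition.le_one (n * x - 1)
  have h3 := Real.smoothTransition.nonneg (n * (1 - x) - 1)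
  have h4 := Real.smoothTransition.le_one (n * (1 - x) - 1)
  constructor <;> linarith

theorem cutoff_eq_zero {n : ℕ} (hn : 4 ≤ n) {x : ℝ} (hx : x ∉ Icc (1 / n : ℝ) (1 - 1 / n)) :
    cutoff n x = 0 := by
  have hn' : (4 : ℝ) ≤ n := by exact_mod_cast hn
  have hinv : (n : ℝ) * (1 / n) = 1 := by field_simp
  have hx' : x < 1 / n ∨ 1 - 1 / n < x := by
    by_contra! hcon
    exact hx hcon
  rw [cutoff]
  rcases hx' with h | h
  · have e1 : (n : ℝ) * x < 1 := by
      rw [← hinv]; exact mul_lt_mul_of_pos_left h (by linarith)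
    rw [Real.smoothTransition.zero_of_nonpos (by linarith),
      Real.smoothTransition.one_of_one_le (by linarith)]
    ring
  · have e1 : (n : ℝ) * (1 - x) < 1 := by
      rw [← hinv]; exact mul_lt_mul_of_pos_left (by linarith) (by linarith)
    rw [Real.smoothTransition.zero_of_nonpos (x := n * (1 - x) - 1) (by linarith),
      Real.smoothTransition.one_of_one_le (by linarith)]
    ring

theorem tendsto_cutoff {x : ℝ} (hx : x ∈ Ioo (0 : ℝ) 1) :
    Filter.Tendsto (fun n => cutoff n x) Filter.atTop (nhds 1) := by
  have h : ∀ {y : ℝ}, 0 < y → ∀ᶠ n : ℕ in Filter.atTop,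
      Real.smoothTransition (n * y - 1) = 1 := fun {y} hy => by
    have := (tendsto_natCast_atTop_atTop (R := ℝ)).atTop_mul_const hy
    filter_upwards [this.eventually_ge_atTop 2] with n hn
    exact Real.smoothTransition.one_of_one_le (by linarith)
  refine tendsto_const_nhds.congr' ?_
  filter_upwards [h hx.1, h (y := 1 - x) (by linarith [hx.2])] with n h1 h2
  rw [cutoff, h1, h2]; ring

theorem isTest_cutoff_mul {n : ℕ} (hn : 4 ≤ n) {φ : ℝ × ℝ → ℝ} (hφ : ContDiff ℝ ∞ φ) :
    IsTest fun z => cutoff n z.1 * cutoff n z.2 * φ z := by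
  have hn' : (0 : ℝ) < n := by exact_mod_cast (by omega : 0 < n)
  refine isTest_iff.2 ⟨(((contDiff_cutoff n).comp contDiff_fst).mul
    ((contDiff_cutoff n).comp contDiff_snd)).mul hφ, 1 / n, by positivity, fun z hz => ?_⟩
  by_cases h1 : z.1 ∈ Icc (1 / n : ℝ) (1 - 1 / n)
  · rw [cutoff_eq_zero hn (x := z.2) fun h2 => hz ⟨h1, h2⟩]; ring
  · rw [cutoff_eq_zero hn h1]; ring

theorem deriv_smoothTransition_of_nonpos {x : ℝ} (hx : x ≤ 0) :
    deriv Real.smoothTransition x = 0 := by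
  apply IsLocalMin.deriv_eq_zero
  refine Filter.Eventually.of_forall fun y => ?_
  rw [Real.smoothTransition.zero_of_nonpos hx]
  exact Real.smoothTransition.nonneg y

theorem deriv_smoothTransition_of_one_le {x : ℝ} (hx : 1 ≤ x) :
    deriv Real.smoothTransition x = 0 := by
  apply IsLocalMax.deriv_eq_zero
  refine Filter.Eventually.of_forall fun y => ?_
  rw [Real.smoothTransition.one_of_one_le hx]
  exact Real.smoothTransition.le_one y

/-- The substitution `x = (r + 1) / n`. The derivative of the transition function vanishes outside
`[0, 1]`, so the domain of integration does not depend on `n`. -/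
theorem integral_smoothTransition_comp {n : ℕ} (hn : 2 ≤ n) {g : ℝ → ℝ} (hg : Continuous g) :
    ∫ x in (0 : ℝ)..1, n * deriv Real.smoothTransition (n * x - 1) * g x =
      ∫ r in (0 : ℝ)..1, deriv Real.smoothTransition r * g ((r + 1) / n) := by
  have hn' : (2 : ℝ) ≤ n := by exact_mod_cast hn
  have hn0 : (n : ℝ) ≠ 0 := by positivity
  have hs := continuous_deriv_smoothTransition
  have hc : Continuous fun r : ℝ => deriv Real.smoothTransition r * g ((r + 1) / n) := by fun_prop
  have h1 := intervalIntegral.integral_comp_mul_sub (a := 0) (b := 1)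
    (fun r : ℝ => deriv Real.smoothTransition r * g ((r + 1) / n)) hn0 1
  have h2 : ∀ x : ℝ, n * deriv Real.smoothTransition (n * x - 1) * g x =
      n * (deriv Real.smoothTransition (n * x - 1) * g ((n * x - 1 + 1) / n)) := fun x => by
    rw [sub_add_cancel, mul_div_cancel_left₀ _ hn0, mul_assoc]
  simp_rw [h2]
  rw [intervalIntegral.integral_const_mul, h1, smul_eq_mul, mul_inv_cancel_left₀ hn0, mul_zero,
    zero_sub, mul_one,
    ← intervalIntegral.integral_add_adjacent_intervals (b := 0) (hc.intervalIntegrable _ _)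
      (hc.intervalIntegrable _ _),
    ← intervalIntegral.integral_add_adjacent_intervals (a := 0) (b := 1)
      (hc.intervalIntegrable _ _) (hc.intervalIntegrable _ _)]
  have z1 : ∫ r in (-1 : ℝ)..0, deriv Real.smoothTransition r * g ((r + 1) / n) = 0 := by
    apply intervalIntegral.integral_zero_ae
    refine Filter.Eventually.of_forall fun r hr => ?_
    rw [uIoc_of_le (by norm_num)] at hr
    rw [deriv_smoothTransition_of_nonpos hr.2, zero_mul]
  have z2 : ∫ r in (1 : ℝ)..(n - 1), deriv Real.smoothTransition r * g ((r + 1) / n) = 0 := by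
    apply intervalIntegral.integral_zero_ae
    refine Filter.Eventually.of_forall fun r hr => ?_
    rw [uIoc_of_le (by linarith)] at hr
    rw [deriv_smoothTransition_of_one_le hr.1.le, zero_mul]
  rw [z1, z2]; ring

theorem integral_cutoffDeriv_mul {n : ℕ} (hn : 2 ≤ n) {g : ℝ → ℝ} (hg : Continuous g) :
    ∫ x in (0 : ℝ)..1, cutoffDeriv n x * g x =
      ∫ r in (0 : ℝ)..1, deriv Real.smoothTransition r *
        (g ((r + 1) / n) - g (1 - (r + 1) / n)) := by
  have hs := continuous_deriv_smoothTransition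
  have hsplit : ∀ x, cutoffDeriv n x * g x =
      n * deriv Real.smoothTransition (n * x - 1) * g x -
        n * deriv Real.smoothTransition (n * (1 - x) - 1) * g x := fun x => by
    rw [cutoffDeriv, sub_mul]
  have hrefl := intervalIntegral.integral_comp_sub_left (a := 0) (b := 1)
    (fun x : ℝ => n * deriv Real.smoothTransition (n * x - 1) * g (1 - x)) 1
  simp only [sub_sub_cancel, sub_self, sub_zero] at hrefl
  simp_rw [hsplit, mul_sub (deriv Real.smoothTransition _)]
  rw [intervalIntegral.integral_sub (Continuous.intervalIntegrable (by fun_prop) _ _)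
      (Continuous.intervalIntegrable (by fun_prop) _ _), hrefl,
    integral_smoothTransition_comp hn hg,
    integral_smoothTransition_comp hn (g := fun x => g (1 - x)) (by fun_prop),
    intervalIntegral.integral_sub (Continuous.intervalIntegrable (by fun_prop) _ _)
      (Continuous.intervalIntegrable (by fun_prop) _ _)]

/-- The derivatives of the cutoff functions in the first variable converge to the difference of
the Dirac masses on the left and right faces. -/
theorem tendsto_integral_cutoffDeriv {F : ℝ × ℝ → ℝ} (hF : Continuous F) :
    Filter.Tendsto (fun n : ℕ => ∫ z, cutoffDeriv n z.1 * (cutoff n z.2 * F z) ∂squareMeasure)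
      Filter.atTop
      (nhds ((∫ t in (0 : ℝ)..1, F (0, t)) - ∫ t in (0 : ℝ)..1, F (1, t))) := by
  have hs := continuous_deriv_smoothTransition
  have hcut : ∀ n, Continuous (cutoff n) := fun n => (contDiff_cutoff n).continuous
  have hcd := continuous_cutoffDeriv
  -- The substitution `x = (r + 1) / n` removes the singular factor `n` from the derivative.
  have step : ∀ n : ℕ, 2 ≤ n → ∫ z, cutoffDeriv n z.1 * (cutoff n z.2 * F z) ∂squareMeasure =
      ∫ z, deriv Real.smoothTransition z.1 * (cutoff n z.2 *
        (F ((z.1 + 1) / n, z.2) - F (1 - (z.1 + 1) / n, z.2))) ∂squareMeasure := fun n hn => by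
    have i1 : Integrable (fun z : ℝ × ℝ => cutoffDeriv n z.1 * (cutoff n z.2 * F z))
        (unitMeasure.prod unitMeasure) := by
      rw [← squareMeasure_eq_prod]
      exact integrable_of_continuous (by fun_prop)
    have i2 : Integrable (fun z : ℝ × ℝ => deriv Real.smoothTransition z.1 * (cutoff n z.2 *
        (F ((z.1 + 1) / n, z.2) - F (1 - (z.1 + 1) / n, z.2))))
        (unitMeasure.prod unitMeasure) := by
      rw [← squareMeasure_eq_prod]
      exact integrable_of_continuous (by fun_prop)
    rw [squareMeasure_eq_prod, integral_prod_symm _ i1, integral_prod_symm _ i2]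
    congr 1
    ext y
    rw [← intervalIntegral_eq_unitMeasure, ← intervalIntegral_eq_unitMeasure,
      integral_cutoffDeriv_mul hn (g := fun x => cutoff n y * F (x, y)) (by fun_prop)]
    simp_rw [mul_sub]
  have hlim : (∫ t in (0 : ℝ)..1, F (0, t)) - ∫ t in (0 : ℝ)..1, F (1, t) =
      ∫ z, deriv Real.smoothTransition z.1 * (F (0, z.2) - F (1, z.2)) ∂squareMeasure := by
    have hone : ∫ t in (0 : ℝ)..1, deriv Real.smoothTransition t = 1 := by
      rw [intervalIntegral.integral_eq_sub_of_hasDerivAt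
        (fun x _ => hasDerivAt_smoothTransition x) (hs.intervalIntegrable _ _)]
      simp
    rw [integral_square_mul (deriv Real.smoothTransition) fun y => F (0, y) - F (1, y), hone,
      one_mul, intervalIntegral.integral_sub (Continuous.intervalIntegrable (by fun_prop) _ _)
      (Continuous.intervalIntegrable (by fun_prop) _ _)]
  rw [hlim]
  obtain ⟨M, hM⟩ := isCompact_closedSquare.exists_bound_of_continuousOn hF.continuousOn
  obtain ⟨D, hD⟩ := (isCompact_Icc (a := (0 : ℝ)) (b := 1)).exists_bound_of_continuousOn
    hs.continuousOn
  have hM0 : 0 ≤ M := (norm_nonneg _).trans (hM (0, 0) (by simp [closedSquare]))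
  have hD0 : 0 ≤ D := (norm_nonneg _).trans (hD 0 (by simp))
  have hmain : Filter.Tendsto (fun n : ℕ => ∫ z, deriv Real.smoothTransition z.1 * (cutoff n z.2 *
        (F ((z.1 + 1) / n, z.2) - F (1 - (z.1 + 1) / n, z.2))) ∂squareMeasure) Filter.atTop
      (nhds (∫ z, deriv Real.smoothTransition z.1 * (F (0, z.2) - F (1, z.2))
        ∂squareMeasure)) := by
    refine tendsto_integral_filter_of_dominated_convergence (fun _ => D * (1 * (M + M)))
      (Filter.Eventually.of_forall fun n => ?_) ?_ (integrable_const _) ?_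
    · exact Continuous.aestronglyMeasurable (by fun_prop)
    · filter_upwards [Filter.eventually_ge_atTop 2] with n hn
      filter_upwards [ae_mem_closedSquare] with z hz
      have hn' : (2 : ℝ) ≤ n := by exact_mod_cast hn
      have q0 : 0 ≤ (z.1 + 1) / n := div_nonneg (by linarith [hz.1.1]) (by linarith)
      have q1 : (z.1 + 1) / n ≤ 1 := (div_le_one (by linarith)).2 (by linarith [hz.1.2])
      rw [norm_mul, norm_mul]
      refine mul_le_mul (hD _ hz.1) (mul_le_mul (abs_cutoff_le n _) ?_ (norm_nonneg _) zero_le_one)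
        (by positivity) hD0
      exact (norm_sub_le _ _).trans (add_le_add (hM _ ⟨⟨q0, q1⟩, hz.2⟩)
        (hM _ ⟨⟨by linarith, by linarith⟩, hz.2⟩))
    · filter_upwards [ae_mem_openSquare] with z hz
      have hq : Filter.Tendsto (fun n : ℕ => (z.1 + 1) / (n : ℝ)) Filter.atTop (nhds 0) :=
        tendsto_const_nhds.div_atTop tendsto_natCast_atTop_atTop
      have c1 : Filter.Tendsto (fun n : ℕ => F ((z.1 + 1) / (n : ℝ), z.2)) Filter.atTop
          (nhds (F (0, z.2))) :=
        (hF.tendsto _).comp (hq.prodMk_nhds tendsto_const_nhds)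
      have c2 : Filter.Tendsto (fun n : ℕ => F (1 - (z.1 + 1) / (n : ℝ), z.2)) Filter.atTop
          (nhds (F (1, z.2))) := by
        have := (hq.const_sub 1)
        rw [sub_zero] at this
        exact (hF.tendsto _).comp (this.prodMk_nhds tendsto_const_nhds)
      have := ((tendsto_cutoff hz.2).mul (c1.sub c2)).const_mul (deriv Real.smoothTransition z.1)
      rwa [one_mul] at this
  refine hmain.congr' ?_
  filter_upwards [Filter.eventually_ge_atTop 2] with n hn
  exact (step n hn).symm

theorem tendsto_integral_cutoff_mul {f : ℝ × ℝ → ℝ} (hf : Integrable f squareMeasure) :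
    Filter.Tendsto (fun n : ℕ => ∫ z, cutoff n z.1 * cutoff n z.2 * f z ∂squareMeasure)
      Filter.atTop (nhds (∫ z, f z ∂squareMeasure)) := by
  refine tendsto_integral_filter_of_dominated_convergence (fun z => |f z|)
    (Filter.Eventually.of_forall fun n => ?_) (Filter.Eventually.of_forall fun n => ?_) hf.abs ?_
  · have := (contDiff_cutoff n).continuous
    exact (Continuous.aestronglyMeasurable (by fun_prop)).mul hf.aestronglyMeasurable
  · refine Filter.Eventually.of_forall fun z => ?_
    rw [norm_mul, norm_mul]
    exact mul_le_of_le_one_left (norm_nonneg _)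
      (mul_le_one₀ (abs_cutoff_le n _) (norm_nonneg _) (abs_cutoff_le n _))
  · filter_upwards [ae_mem_openSquare] with z hz
    have := ((tendsto_cutoff hz.1).mul (tendsto_cutoff hz.2)).mul_const (f z)
    rwa [one_mul, one_mul] at this

/-- A field that is continuous up to the boundary satisfies Green's formula: test the weak
divergence with `φ` multiplied by cutoff functions, and pass to the limit. -/
theorem hasNormalTrace_of_continuousOn {u : ℝ × ℝ → ℝ × ℝ} {d : ℝ × ℝ → ℝ}
    (hu : ContinuousOn u closedSquare) (hd : Integrable d squareMeasure) (hud : HasWeakDiv u d) :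
    HasNormalTrace u d := by
  -- Composing with the retraction of the plane onto the square gives a continuous extension.
  let P : ℝ → ℝ := fun x => projIcc (0 : ℝ) 1 zero_le_one x
  have hP : Continuous P := continuous_subtype_val.comp continuous_projIcc
  have hPmem : ∀ x, P x ∈ Icc (0 : ℝ) 1 := fun x => (projIcc (0 : ℝ) 1 zero_le_one x).2
  have hPid : ∀ x ∈ Icc (0 : ℝ) 1, P x = x := fun x hx =>
    congrArg Subtype.val (projIcc_of_mem zero_le_one hx)
  set v : ℝ × ℝ → ℝ × ℝ := fun z => u (P z.1, P z.2) with hv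
  have hvc : Continuous v := hu.comp_continuous (by fun_prop) fun z => ⟨hPmem _, hPmem _⟩
  have hvu : ∀ z ∈ closedSquare, v z = u z := fun z hz => by
    simp only [hv]
    rw [hPid _ hz.1, hPid _ hz.2]
  intro φ hφ
  have hφd : ∀ z, DifferentiableAt ℝ φ z := fun z => hφ.differentiable (by simp) z
  have hφx := continuous_partialX hφ
  have hφy := continuous_partialY hφ
  have hφc := hφ.continuous
  have hv1 : Continuous fun z => (v z).1 := hvc.fst
  have hv2 : Continuous fun z => (v z).2 := hvc.snd
  have hdφ : Integrable (fun z => d z * φ z) squareMeasure := integrable_mul_continuous hd hφc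
  have hI : Continuous fun z => dot (v z) (grad φ z) := (hv1.mul hφx).add (hv2.mul hφy)
  have identity : ∀ n : ℕ, 4 ≤ n →
      ∫ z, cutoff n z.1 * cutoff n z.2 * dot (v z) (grad φ z) ∂squareMeasure +
      ∫ z, cutoff n z.1 * cutoff n z.2 * (d z * φ z) ∂squareMeasure =
      -(∫ z, cutoffDeriv n z.1 * (cutoff n z.2 * ((v z).1 * φ z)) ∂squareMeasure) -
        ∫ z, cutoffDeriv n z.1 * (cutoff n z.2 * ((v z.swap).2 * φ z.swap)) ∂squareMeasure := by
    intro n hn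
    have hc := (contDiff_cutoff n).continuous
    have hc' := continuous_cutoffDeriv n
    have key := hud.2.2 _ (isTest_cutoff_mul hn hφ)
    rw [setIntegral_openSquare, setIntegral_openSquare] at key
    have hcd : ∀ z : ℝ × ℝ, DifferentiableAt ℝ (fun z : ℝ × ℝ => cutoff n z.1 * cutoff n z.2) z :=
      fun z => (((contDiff_cutoff n).comp contDiff_fst).mul
        ((contDiff_cutoff n).comp contDiff_snd)).differentiable (by simp) z
    have gx : ∀ z : ℝ × ℝ, partialX (fun z => cutoff n z.1 * cutoff n z.2 * φ z) z =
        cutoff n z.1 * cutoff n z.2 * partialX φ z + cutoffDeriv n z.1 * cutoff n z.2 * φ z := by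
      rintro ⟨x, y⟩
      rw [partialX_mul (hcd _) (hφd _), partialX_eq_of_hasDerivAt (hcd _)
        ((hasDerivAt_cutoff n x).mul_const (cutoff n y))]
    have gy : ∀ z : ℝ × ℝ, partialY (fun z => cutoff n z.1 * cutoff n z.2 * φ z) z =
        cutoff n z.1 * cutoff n z.2 * partialY φ z + cutoff n z.1 * cutoffDeriv n z.2 * φ z := by
      rintro ⟨x, y⟩
      rw [partialY_mul (hcd _) (hφd _), partialY_eq_of_hasDerivAt (hcd _)
        ((hasDerivAt_cutoff n y).const_mul (cutoff n x))]
    have hL : ∫ z, dot (u z) (grad (fun z => cutoff n z.1 * cutoff n z.2 * φ z) z) ∂squareMeasure =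
        ∫ z, (cutoff n z.1 * cutoff n z.2 * dot (v z) (grad φ z) +
          (cutoffDeriv n z.1 * (cutoff n z.2 * ((v z).1 * φ z)) +
          cutoff n z.1 * (cutoffDeriv n z.2 * ((v z).2 * φ z)))) ∂squareMeasure := by
      refine integral_congr_ae ?_
      filter_upwards [ae_mem_closedSquare] with z hz
      simp only [dot, grad]
      rw [← hvu z hz, gx, gy]
      ring
    have hsw : ∫ z, cutoff n z.1 * (cutoffDeriv n z.2 * ((v z).2 * φ z)) ∂squareMeasure =
        ∫ z, cutoffDeriv n z.1 * (cutoff n z.2 * ((v z.swap).2 * φ z.swap)) ∂squareMeasure := by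
      rw [squareMeasure_eq_prod, ← integral_prod_swap]
      refine integral_congr_ae (Filter.Eventually.of_forall fun z => ?_)
      simp only [Prod.fst_swap, Prod.snd_swap]
      ring
    have hR : ∀ z, cutoff n z.1 * cutoff n z.2 * (d z * φ z) =
        d z * (cutoff n z.1 * cutoff n z.2 * φ z) := fun z => by ring
    rw [hL, integral_add (integrable_of_continuous (by fun_prop))
      (integrable_of_continuous (by fun_prop)), integral_add
      (integrable_of_continuous (by fun_prop)) (integrable_of_continuous (by fun_prop)), hsw] at key
    simp_rw [hR]
    linarith
  have lim1 := (tendsto_integral_cutoff_mul (integrable_of_continuous hI)).add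
    (tendsto_integral_cutoff_mul hdφ)
  have lim2 := (tendsto_integral_cutoffDeriv (F := fun z => (v z).1 * φ z) (hv1.mul hφc)).neg.sub
    (tendsto_integral_cutoffDeriv (F := fun z => (v z.swap).2 * φ z.swap) (by fun_prop))
  have lim3 := lim2.congr' (Filter.EventuallyEq.symm (by
    filter_upwards [Filter.eventually_ge_atTop 4] with n hn
    exact identity n hn))
  have final := tendsto_nhds_unique lim1 lim3
  have e1 : ∫ z in closedSquare, dot (u z) (grad φ z) =
      ∫ z, dot (v z) (grad φ z) ∂squareMeasure := by
    refine integral_congr_ae ?_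
    filter_upwards [ae_mem_closedSquare] with z hz
    rw [hvu z hz]
  have hface : ∀ (F : Face) (t : ℝ), t ∈ Icc (0 : ℝ) 1 → F.param t ∈ closedSquare := by
    intro F t ht
    cases F <;> simp_all [Face.param, closedSquare]
  have hn : ∀ F : Face, ∫ t in (0 : ℝ)..1, normalComp u F t * φ (F.param t) =
      ∫ t in (0 : ℝ)..1, normalComp v F t * φ (F.param t) := fun F => by
    refine intervalIntegral.integral_congr fun t ht => ?_
    rw [uIcc_of_le zero_le_one] at ht
    simp only [normalComp]
    rw [hvu _ (hface F t ht)]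
  rw [e1, hn, hn, hn, hn]
  refine final.trans ?_
  simp only [normalComp, dot, Face.param, Face.normal, Prod.swap_prod_mk, mul_neg, mul_one,
    mul_zero, add_zero, zero_add, neg_mul, intervalIntegral.integral_neg]
  ring

/-! ### The divergence of the interpolant -/

theorem partialX_monomial (i j : ℕ) (z : ℝ × ℝ) :
    partialX (fun z : ℝ × ℝ => z.1 ^ i * z.2 ^ j) z = i * (z.1 ^ (i - 1) * z.2 ^ j) := by
  obtain ⟨x, y⟩ := z
  have hd : DifferentiableAt ℝ (fun z : ℝ × ℝ => z.1 ^ i * z.2 ^ j) (x, y) := by fun_prop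
  rw [partialX_eq_of_hasDerivAt hd ((hasDerivAt_pow i x).mul_const (y ^ j)), mul_assoc]

theorem partialY_monomial (i j : ℕ) (z : ℝ × ℝ) :
    partialY (fun z : ℝ × ℝ => z.1 ^ i * z.2 ^ j) z = j * (z.1 ^ i * z.2 ^ (j - 1)) := by
  obtain ⟨x, y⟩ := z
  have hd : DifferentiableAt ℝ (fun z : ℝ × ℝ => z.1 ^ i * z.2 ^ j) (x, y) := by fun_prop
  rw [partialY_eq_of_hasDerivAt hd ((hasDerivAt_pow j y).const_mul (x ^ i)), mul_left_comm]

theorem partialX_mem_polyLT {m n : ℕ} {f : ℝ × ℝ → ℝ} (hf : f ∈ polyLT (m + 1) n) :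
    partialX f ∈ polyLT m n := by
  have hd : ∀ {f : ℝ × ℝ → ℝ}, f ∈ polyLT (m + 1) n → ∀ z, DifferentiableAt ℝ f z :=
    fun hf z => (contDiff_of_mem_polyLT hf).differentiable (by simp) z
  induction hf using Submodule.span_induction with
  | mem f hf =>
    obtain ⟨i, j, hi, hj, rfl⟩ := hf
    have : partialX (fun z : ℝ × ℝ => z.1 ^ i * z.2 ^ j) =
        (i : ℝ) • fun z : ℝ × ℝ => z.1 ^ (i - 1) * z.2 ^ j := funext (partialX_monomial i j)
    rw [this]
    rcases Nat.eq_zero_or_pos i with rfl | hpos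
    · simp
    · exact Submodule.smul_mem _ _ (monomial_mem_polyLT (by omega) hj)
  | zero =>
    have : partialX (0 : ℝ × ℝ → ℝ) = 0 := by ext z; simp [partialX]
    rw [this]
    exact Submodule.zero_mem _
  | add f g hf hg ihf ihg =>
    have : partialX (f + g) = partialX f + partialX g := by
      ext z
      simp only [partialX, Pi.add_apply]
      rw [fderiv_add (hd hf z) (hd hg z)]
      rfl
    rw [this]
    exact Submodule.add_mem _ ihf ihg
  | smul a f hf ih =>
    have : partialX (a • f) = a • partialX f := by
      ext z
      simp only [partialX, Pi.smul_apply]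
      rw [fderiv_const_smul (hd hf z)]
      rfl
    rw [this]
    exact Submodule.smul_mem _ _ ih

theorem partialX_comp_swap {f : ℝ × ℝ → ℝ} (hf : Differentiable ℝ f) (z : ℝ × ℝ) :
    partialX (fun z => f z.swap) z = partialY f z.swap := by
  have h : HasFDerivAt (fun z : ℝ × ℝ => z.swap)
      ((ContinuousLinearMap.snd ℝ ℝ ℝ).prod (ContinuousLinearMap.fst ℝ ℝ ℝ)) z :=
    ((ContinuousLinearMap.snd ℝ ℝ ℝ).prod (ContinuousLinearMap.fst ℝ ℝ ℝ)).hasFDerivAt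
  have h2 : HasFDerivAt (fun z : ℝ × ℝ => f z.swap) _ z := (hf z.swap).hasFDerivAt.comp z h
  rw [partialX, partialY, h2.fderiv]
  simp

theorem partialY_mem_polyLT {m n : ℕ} {f : ℝ × ℝ → ℝ} (hf : f ∈ polyLT m (n + 1)) :
    partialY f ∈ polyLT m n := by
  have h := comp_swap_mem_polyLT (partialX_mem_polyLT (comp_swap_mem_polyLT hf))
  simpa only [partialX_comp_swap ((contDiff_of_mem_polyLT hf).differentiable (by simp)),
    Prod.swap_swap] using h

theorem MemRT.divergence_mem {k : ℕ} {w : ℝ × ℝ → ℝ × ℝ} (hw : MemRT k w) :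
    divergence w ∈ polyLT (k + 1) (k + 1) :=
  Submodule.add_mem _ (partialX_mem_polyLT hw.1) (partialY_mem_polyLT hw.2)

/-- The commuting diagram property: the divergence of the interpolant is the `L²` projection of
the divergence onto `Q_{k,k}`. For `φ` in this space, `∇φ` and the traces of `φ` on the faces are
among the test functions that define the interpolant. -/
theorem IsRTInterpolant.integral_divergence_mul {k : ℕ} {u w : ℝ × ℝ → ℝ × ℝ} {d : ℝ × ℝ → ℝ}
    (hu : HasMoments u) (hd : HasNormalTrace u d) (hw : IsRTInterpolant k u w) {i j : ℕ}
    (hi : i < k + 1) (hj : j < k + 1) :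
    ∫ z, divergence w z * (z.1 ^ i * z.2 ^ j) ∂squareMeasure =
      ∫ z, d z * (z.1 ^ i * z.2 ^ j) ∂squareMeasure := by
  obtain ⟨hRT, hF, h1, h2⟩ := (isRTInterpolant_iff hu).1 hw
  have hφ : ContDiff ℝ ∞ fun z : ℝ × ℝ => z.1 ^ i * z.2 ^ j :=
    (contDiff_fst.pow i).mul (contDiff_snd.pow j)
  have g1 := hasNormalTrace_of_contDiff hRT.contDiff _ hφ
  have g2 := hd _ hφ
  have hvol : ∀ v : ℝ × ℝ → ℝ × ℝ, HasMoments v →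
      ∫ z in closedSquare, dot (v z) (grad (fun z : ℝ × ℝ => z.1 ^ i * z.2 ^ j) z) =
      i * ∫ z, (v z).1 * (z.1 ^ (i - 1) * z.2 ^ j) ∂squareMeasure +
        j * ∫ z, (v z).2 * (z.1 ^ i * z.2 ^ (j - 1)) ∂squareMeasure := fun v hv => by
    rw [← integral_const_mul, ← integral_const_mul, ← integral_add]
    · refine integral_congr_ae (Filter.Eventually.of_forall fun z => ?_)
      simp only [dot, grad]
      rw [partialX_monomial, partialY_monomial]
      ring
    · exact (integrable_mul_continuous hv.integrable_fst (by fun_prop)).const_mul _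
    · exact (integrable_mul_continuous hv.integrable_snd (by fun_prop)).const_mul _
  have hgrad : ∫ z in closedSquare, dot (w z) (grad (fun z : ℝ × ℝ => z.1 ^ i * z.2 ^ j) z) =
      ∫ z in closedSquare, dot (u z) (grad (fun z : ℝ × ℝ => z.1 ^ i * z.2 ^ j) z) := by
    rw [hvol w hRT.hasMoments, hvol u hu]
    congr 1
    · rcases Nat.eq_zero_or_pos i with rfl | hpos
      · simp
      · rw [h1 _ _ (by omega) hj]
    · rcases Nat.eq_zero_or_pos j with rfl | hpos
      · simp
      · rw [h2 _ _ hi (by omega)]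
  have hface : ∀ F : Face,
      ∫ t in (0 : ℝ)..1, normalComp w F t * ((F.param t).1 ^ i * (F.param t).2 ^ j) =
        ∫ t in (0 : ℝ)..1, normalComp u F t * ((F.param t).1 ^ i * (F.param t).2 ^ j) := by
    have aux : ∀ (F : Face) (c : ℝ) (m : ℕ), m < k + 1 →
        (∀ t, (F.param t).1 ^ i * (F.param t).2 ^ j = c * t ^ m) →
        ∫ t in (0 : ℝ)..1, normalComp w F t * ((F.param t).1 ^ i * (F.param t).2 ^ j) =
          ∫ t in (0 : ℝ)..1, normalComp u F t * ((F.param t).1 ^ i * (F.param t).2 ^ j) := by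
      intro F c m hm h
      simp_rw [h, mul_left_comm _ c]
      rw [intervalIntegral.integral_const_mul, intervalIntegral.integral_const_mul, hF F m hm]
    rintro (_ | _ | _ | _)
    · exact aux .left (0 ^ i) j hj fun _ => rfl
    · exact aux .right (1 ^ i) j hj fun _ => rfl
    · exact aux .bottom (0 ^ j) i hi fun _ => mul_comm _ _
    · exact aux .top (1 ^ j) i hi fun _ => mul_comm _ _
  rw [hgrad, hface, hface, hface, hface, ← g2] at g1
  exact add_left_cancel g1

/-! ### Exchanging the variables -/

theorem partialY_comp_swap {f : ℝ × ℝ → ℝ} (hf : Differentiable ℝ f) :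
    partialY (fun z => f z.swap) = fun z => partialX f z.swap := by
  have hs : Differentiable ℝ fun z : ℝ × ℝ => f z.swap :=
    hf.comp (differentiable_snd.prodMk differentiable_fst)
  ext z
  have := partialX_comp_swap hs z.swap
  simp only [Prod.swap_swap] at this
  exact this.symm

theorem contDiff_partialX {f : ℝ × ℝ → ℝ} (hf : ContDiff ℝ ∞ f) : ContDiff ℝ ∞ (partialX f) :=
  (hf.fderiv_right (by simp)).clm_apply contDiff_const

theorem iterate_partialY_comp_swap (n : ℕ) : ∀ {f : ℝ × ℝ → ℝ}, ContDiff ℝ ∞ f →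
    partialY^[n] (fun z => f z.swap) = fun z => partialX^[n] f z.swap := by
  induction n with
  | zero => exact fun _ => rfl
  | succ n ih =>
    intro f hf
    rw [Function.iterate_succ_apply, partialY_comp_swap (hf.differentiable (by simp)),
      ih (contDiff_partialX hf), Function.iterate_succ_apply]

theorem IsTest.comp_swap {φ : ℝ × ℝ → ℝ} (hφ : IsTest φ) : IsTest fun z => φ z.swap := by
  obtain ⟨hs, a, ha, hz⟩ := isTest_iff.1 hφ
  exact isTest_iff.2 ⟨hs.comp (contDiff_snd.prodMk contDiff_fst), a, ha,
    fun z hzm => hz _ fun hm => hzm ⟨hm.2, hm.1⟩⟩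

theorem integral_square_swap (f : ℝ × ℝ → ℝ) :
    ∫ z, f z.swap ∂squareMeasure = ∫ z, f z ∂squareMeasure := by
  rw [squareMeasure_eq_prod, integral_prod_swap]

theorem integrable_square_swap {f : ℝ × ℝ → ℝ} (hf : Integrable f squareMeasure) :
    Integrable (fun z => f z.swap) squareMeasure := by
  rw [squareMeasure_eq_prod] at *
  exact hf.swap

theorem ae_square_swap {P : ℝ × ℝ → Prop} (h : ∀ᵐ z ∂squareMeasure, P z) :
    ∀ᵐ z ∂squareMeasure, P z.swap := by
  rw [squareMeasure_eq_prod] at *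
  exact Measure.measurePreserving_swap.quasiMeasurePreserving.ae h

theorem HasWeakDeriv.hasXDeriv_swap {n : ℕ} {f g : ℝ × ℝ → ℝ} (h : HasWeakDeriv 0 n f g) :
    HasXDeriv n (fun z => f z.swap) (fun z => g z.swap) := fun φ hφ => by
  have key := h.2.2 _ hφ.comp_swap
  rw [Function.iterate_zero, id, iterate_partialY_comp_swap n hφ.1, setIntegral_openSquare,
    setIntegral_openSquare, zero_add, ← integral_square_swap,
    ← integral_square_swap fun z => g z * φ z.swap] at key
  simpa only [Prod.swap_swap] using key

/-! ### The averaged projection in both variables -/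

theorem integrable_rowNorm {f : ℝ × ℝ → ℝ} (hf : Integrable f squareMeasure) :
    Integrable (rowNorm f) unitMeasure := by
  rw [squareMeasure_eq_prod] at hf
  exact hf.abs.integral_prod_right

theorem integral_comp_snd (c : ℝ → ℝ) :
    ∫ z, c z.2 ∂squareMeasure = ∫ y, c y ∂unitMeasure := by
  have := integral_prod_mul (μ := unitMeasure) (ν := unitMeasure) (fun _ => (1 : ℝ)) c
  simpa [squareMeasure_eq_prod] using this

theorem integrable_comp_snd {c : ℝ → ℝ} (hc : Integrable c unitMeasure) :
    Integrable (fun z : ℝ × ℝ => c z.2) squareMeasure := by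
  rw [squareMeasure_eq_prod]
  exact hc.comp_snd unitMeasure

theorem integral_rowNorm {f : ℝ × ℝ → ℝ} (hf : Integrable f squareMeasure) :
    ∫ y, rowNorm f y ∂unitMeasure = ∫ z, |f z| ∂squareMeasure := by
  have h := hf.abs
  rw [squareMeasure_eq_prod] at h ⊢
  rw [integral_prod_symm _ h]
  rfl

/-- The averaged projection in the second variable. -/
noncomputable def yProjection {n : ℕ} (η : Fin n → ℝ → ℝ) (f : ℝ × ℝ → ℝ) (z : ℝ × ℝ) : ℝ :=
  xOperator (polyKernel η) (fun z => f z.swap) z.swap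

theorem integrable_yProjection {n : ℕ} {η : Fin n → ℝ → ℝ} {C : ℝ}
    (hK : BoundedKernel (polyKernel η) C) {f : ℝ × ℝ → ℝ} (hf : Integrable f squareMeasure) :
    Integrable (yProjection η f) squareMeasure :=
  integrable_square_swap (integrable_xOperator hK (integrable_square_swap hf))

/-- Projecting in both variables gives a polynomial. -/
theorem xOperator_yProjection_mem {n : ℕ} {η : Fin n → ℝ → ℝ} (hη : IsDualSystem η)
    {f : ℝ × ℝ → ℝ} (hf : Integrable f squareMeasure) :
    xOperator (polyKernel η) (yProjection η f) ∈ polyLT n n := by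
  set e : Fin n → ℝ → ℝ := fun i t => ∫ s, η i s * f (t, s) ∂unitMeasure with he
  have hbound : ∀ i, ∃ D, ∀ t, |η i t| ≤ D := fun i => by
    obtain ⟨a, -, h0⟩ := hη.2.1
    exact (HasCompactSupport.intro isCompact_Icc (h0 i)).exists_bound_of_continuous
      (hη.1 i).continuous
  have hei : ∀ i, Integrable (e i) unitMeasure := fun i => by
    obtain ⟨D, hD⟩ := hbound i
    have h1 : Integrable (fun z : ℝ × ℝ => η i z.2 * f z) squareMeasure :=
      hf.bdd_mul (c := D) ((hη.1 i).continuous.comp continuous_snd).aestronglyMeasurable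
        (Filter.Eventually.of_forall fun z => hD _)
    rw [squareMeasure_eq_prod] at h1
    exact h1.integral_prod_left
  have hηe : ∀ i j, Integrable (fun t => η j t * e i t) unitMeasure := fun i j => by
    obtain ⟨D, hD⟩ := hbound j
    exact (hei i).bdd_mul (c := D) (hη.1 j).continuous.aestronglyMeasurable
      (Filter.Eventually.of_forall hD)
  have hY : ∀ᵐ t ∂unitMeasure, ∀ y,
      yProjection η f (t, y) = ∑ i : Fin n, y ^ (i : ℕ) * e i t := by
    filter_upwards [ae_integrable_row (integrable_square_swap hf)] with t ht y
    simp only [yProjection, xOperator, polyKernel, Prod.swap_prod_mk, Finset.sum_mul]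
    rw [integral_finsetSum]
    · refine Finset.sum_congr rfl fun i _ => ?_
      simp_rw [mul_assoc]
      rw [integral_const_mul]
    · intro i _
      obtain ⟨D, hD⟩ := hbound i
      simp_rw [mul_assoc]
      exact (ht.bdd_mul (c := D) (hη.1 i).continuous.aestronglyMeasurable
        (Filter.Eventually.of_forall hD)).const_mul _
  -- The equation for `yProjection` holds only for almost every `t`, but it is integrated in `t`, so
  -- the polynomial identity holds at every point.
  refine mem_polyLT_iff.2 ⟨Matrix.of fun j i => ∫ t, η j t * e i t ∂unitMeasure, ?_⟩
  ext ⟨x, y⟩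
  have h1 : xOperator (polyKernel η) (yProjection η f) (x, y) =
      ∫ t, ∑ j : Fin n, ∑ i : Fin n, (x ^ (j : ℕ) * y ^ (i : ℕ)) * (η j t * e i t)
        ∂unitMeasure := by
    refine integral_congr_ae ?_
    filter_upwards [hY] with t ht
    rw [ht, polyKernel, Finset.sum_mul]
    refine Finset.sum_congr rfl fun j _ => ?_
    rw [Finset.mul_sum]
    exact Finset.sum_congr rfl fun i _ => by ring
  rw [h1, integral_finsetSum _ fun j _ => integrable_finsetSum _ fun i _ =>
    (hηe i j).const_mul _]
  refine Finset.sum_congr rfl fun j _ => ?_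
  rw [integral_finsetSum _ fun i _ => (hηe i j).const_mul _]
  refine Finset.sum_congr rfl fun i _ => ?_
  rw [integral_const_mul, mul_comm]
  rfl

/-- The error of the averaged projection in both variables is bounded by the pure derivatives. -/
theorem abs_sub_projection_le {n : ℕ} (hn : 1 ≤ n) {η : Fin n → ℝ → ℝ} (hη : IsDualSystem η)
    {C : ℝ} (hC : 0 ≤ C) (hK : BoundedKernel (polyKernel η) C) {f fx fy : ℝ × ℝ → ℝ}
    (hf : Integrable f squareMeasure) (hfx : Integrable fx squareMeasure)
    (hfy : Integrable fy squareMeasure) (hx : HasWeakDeriv n 0 f fx)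
    (hy : HasWeakDeriv 0 n f fy) :
    ∀ᵐ z ∂squareMeasure, |f z - xOperator (polyKernel η) (yProjection η f) z| ≤
      (1 + C) * rowNorm fx z.2 + C * ((1 + C) * ∫ z, |fy z| ∂squareMeasure) := by
  have hfs := integrable_square_swap hf
  have hfys := integrable_square_swap hfy
  have hYi := integrable_yProjection hK hf
  have b1 := abs_sub_polyKernel_le hn hη hC hK hf hfx hx.hasXDeriv
  have b2 := ae_square_swap (abs_sub_polyKernel_le hn hη hC hK hfs hfys hy.hasXDeriv_swap)
  have b3 : ∀ᵐ y ∂unitMeasure, rowNorm (fun z => f z - yProjection η f z) y ≤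
      (1 + C) * ∫ z, |fy z| ∂squareMeasure := by
    filter_upwards [ae_ae_of_ae_square b2] with y hy2
    rw [← integral_square_swap fun z => |fy z|, ← integral_rowNorm hfys, ← integral_const_mul]
    refine integral_mono_of_nonneg (Filter.Eventually.of_forall fun _ => abs_nonneg _)
      ((integrable_rowNorm hfys).const_mul _) ?_
    filter_upwards [hy2] with x hx2
    exact hx2
  have b4 := abs_xOperator_le hK (hf.sub hYi)
  filter_upwards [b1, ae_snd_of_ae b3, b4, ae_snd_of_ae (ae_integrable_row hf),
    ae_snd_of_ae (ae_integrable_row hYi), ae_mem_closedSquare] with z h1 h3 h4 i1 i2 hz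
  have hbk : ∀ {g : ℝ → ℝ}, Integrable g unitMeasure →
      Integrable (fun t => polyKernel η z.1 t * g t) unitMeasure := fun hg =>
    hg.bdd_mul (c := C) (hK.1.comp (by fun_prop : Measurable fun t : ℝ =>
      (z.1, t))).aestronglyMeasurable (by
        filter_upwards [ae_mem_unit] with t ht
        exact hK.2 _ hz.1 _ ht)
  have hlin : xOperator (polyKernel η) (f - yProjection η f) z =
      xOperator (polyKernel η) f z - xOperator (polyKernel η) (yProjection η f) z := by
    simp only [xOperator, Pi.sub_apply, mul_sub]
    exact integral_sub (hbk i1) (hbk i2)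
  -- `1 - Πₓ Πᵧ = (1 - Πₓ) + Πₓ (1 - Πᵧ)` for the projections in the two variables
  have hsplit : f z - xOperator (polyKernel η) (yProjection η f) z =
      (f z - xOperator (polyKernel η) f z) +
        xOperator (polyKernel η) (f - yProjection η f) z := by
    rw [hlin]; ring
  rw [hsplit]
  exact (abs_add_le _ _).trans (add_le_add h1 (h4.trans (mul_le_mul_of_nonneg_left h3 hC)))

/-! ### The estimate -/

/-- Averaging over horizontal lines does not increase the `L^p` norm, by Jensen's inequality. -/
theorem eLpNorm_rowNorm_le {p : ENNReal} (hp : 1 ≤ p) (hp_top : p ≠ ⊤) {f : ℝ × ℝ → ℝ}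
    (hf : MemLp f p squareMeasure) :
    eLpNorm (fun z : ℝ × ℝ => rowNorm f z.2) p squareMeasure ≤ eLpNorm f p squareMeasure := by
  have hp0 : p ≠ 0 := (zero_lt_one.trans_le hp).ne'
  have hpr : 0 < p.toReal := ENNReal.toReal_pos hp0 hp_top
  have hfi : Integrable f squareMeasure := hf.integrable hp
  rw [eLpNorm_eq_lintegral_rpow_enorm_toReal hp0 hp_top,
    eLpNorm_eq_lintegral_rpow_enorm_toReal hp0 hp_top]
  refine ENNReal.rpow_le_rpow ?_ (by positivity)
  have hfm : AEMeasurable (fun z => ‖f z‖ₑ ^ p.toReal) (unitMeasure.prod unitMeasure) := by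
    rw [← squareMeasure_eq_prod]
    exact hf.1.enorm.pow_const _
  have hrow : ∀ᵐ y ∂unitMeasure, ‖rowNorm f y‖ₑ ^ p.toReal ≤
      ∫⁻ x, ‖f (x, y)‖ₑ ^ p.toReal ∂unitMeasure := by
    filter_upwards [ae_integrable_row hfi] with y hy
    have h1 : ‖rowNorm f y‖ₑ ≤ eLpNorm (fun x => f (x, y)) 1 unitMeasure := by
      rw [eLpNorm_one_eq_lintegral_enorm]
      refine (enorm_integral_le_lintegral_enorm _).trans_eq ?_
      simp_rw [Real.enorm_abs]
    have h2 := h1.trans (eLpNorm_le_eLpNorm_of_exponent_le hp hy.aestronglyMeasurable)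
    rw [eLpNorm_eq_lintegral_rpow_enorm_toReal hp0 hp_top] at h2
    have h3 := ENNReal.rpow_le_rpow h2 hpr.le
    rwa [← ENNReal.rpow_mul, one_div, inv_mul_cancel₀ hpr.ne', ENNReal.rpow_one] at h3
  have hleft : AEMeasurable (fun z : ℝ × ℝ => ‖rowNorm f z.2‖ₑ ^ p.toReal)
      (unitMeasure.prod unitMeasure) := by
    rw [← squareMeasure_eq_prod]
    exact (integrable_comp_snd (integrable_rowNorm hfi)).aestronglyMeasurable.enorm.pow_const _
  rw [squareMeasure_eq_prod, lintegral_prod_symm _ hleft, lintegral_prod_symm _ hfm]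
  refine lintegral_mono_ae ?_
  filter_upwards [hrow] with y hy
  simpa using hy

theorem hasWeakDiv_sub {u w : ℝ × ℝ → ℝ × ℝ} {d : ℝ × ℝ → ℝ}
    (hu : IntegrableOn u closedSquare volume) (hd : Integrable d squareMeasure)
    (hud : HasWeakDiv u d) (hw : ContDiff ℝ ∞ w) :
    HasWeakDiv (fun z => u z - w z) (fun z => d z - divergence w z) := by
  have hwi : IntegrableOn w closedSquare volume :=
    hw.continuous.continuousOn.integrableOn_compact isCompact_closedSquare
  have hdc : Continuous (divergence w) :=
    (continuous_partialX hw.fst).add (continuous_partialY hw.snd)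
  have hwd := (hasNormalTrace_of_contDiff hw).hasWeakDiv hwi (integrable_of_continuous hdc)
  refine ⟨hud.1.sub hwd.1, hud.2.1.sub hwd.2.1, fun φ hφ => ?_⟩
  have e1 := hud.2.2 φ hφ
  have e2 := hwd.2.2 φ hφ
  rw [setIntegral_openSquare, setIntegral_openSquare] at *
  have hdot : ∀ {v : ℝ × ℝ → ℝ × ℝ}, IntegrableOn v closedSquare volume →
      Integrable (fun z => dot (v z) (grad φ z)) squareMeasure := fun hv =>
    (integrable_mul_continuous hv.fst (continuous_partialX hφ.1)).add
      (integrable_mul_continuous hv.snd (continuous_partialY hφ.1))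
  have s1 : ∀ z, dot (u z - w z) (grad φ z) = dot (u z) (grad φ z) - dot (w z) (grad φ z) :=
    fun z => by
      simp only [dot, Prod.fst_sub, Prod.snd_sub]; ring
  simp_rw [s1, sub_mul]
  rw [integral_sub (hdot hu) (hdot hwi), integral_sub (integrable_mul_continuous hd
    hφ.1.continuous) (integrable_mul_continuous (integrable_of_continuous hdc)
    hφ.1.continuous), e1, e2]
  ring

/-- A function whose moments agree with those of a polynomial is approximated by that polynomial
as well as by the averaged projection: both are polynomials, and their difference is bounded by
its moments. -/
theorem exists_abs_sub_le (k ℓ : ℕ) (hℓ : 1 ≤ ℓ) (hℓk : ℓ ≤ k + 1) :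
    ∃ M : ℝ, 0 < M ∧ ∀ f fx fy r : ℝ × ℝ → ℝ, Integrable f squareMeasure →
      Integrable fx squareMeasure → Integrable fy squareMeasure →
      HasWeakDeriv ℓ 0 f fx → HasWeakDeriv 0 ℓ f fy → r ∈ polyLT (k + 1) (k + 1) →
      (∀ i j : ℕ, i < k + 1 → j < k + 1 → ∫ z, r z * (z.1 ^ i * z.2 ^ j) ∂squareMeasure =
        ∫ z, f z * (z.1 ^ i * z.2 ^ j) ∂squareMeasure) →
      ∀ᵐ z ∂squareMeasure, |f z - r z| ≤
        M * (rowNorm fx z.2 + (∫ z, |fx z| ∂squareMeasure + ∫ z, |fy z| ∂squareMeasure)) := by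
  obtain ⟨η, hη⟩ := exists_isDualSystem ℓ
  obtain ⟨C, hC, hK⟩ := hη.exists_boundedKernel
  obtain ⟨D, hD, hmom⟩ := exists_bound_of_moments (k + 1)
  refine ⟨(1 + C) * (1 + C) * (1 + D), by positivity, ?_⟩
  intro f fx fy r hf hfx hfy hx hy hr hrm
  set q := xOperator (polyKernel η) (yProjection η f) with hq
  have hqm : q ∈ polyLT (k + 1) (k + 1) :=
    polyLT_mono hℓk hℓk (xOperator_yProjection_mem hη hf)
  have hqi : Integrable q squareMeasure :=
    integrable_of_continuous (contDiff_of_mem_polyLT hqm).continuous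
  have hri : Integrable r squareMeasure :=
    integrable_of_continuous (contDiff_of_mem_polyLT hr).continuous
  have hfq : Integrable (fun z => f z - q z) squareMeasure := hf.sub hqi
  have hb := abs_sub_projection_le hℓ hη hC hK hf hfx hfy hx hy
  set nx := ∫ z, |fx z| ∂squareMeasure with hnx
  set ny := ∫ z, |fy z| ∂squareMeasure with hny
  have hnx0 : 0 ≤ nx := integral_nonneg fun _ => abs_nonneg _
  have hny0 : 0 ≤ ny := integral_nonneg fun _ => abs_nonneg _
  have hI : ∫ z, |f z - q z| ∂squareMeasure ≤ (1 + C) * nx + C * ((1 + C) * ny) := by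
    have hrow := integrable_comp_snd (integrable_rowNorm hfx)
    have := integral_mono_ae hfq.abs ((hrow.const_mul (1 + C)).add (integrable_const _)) hb
    refine this.trans_eq ?_
    simp only [Pi.add_apply]
    rw [integral_add (hrow.const_mul (1 + C)) (integrable_const _), integral_const_mul,
      integral_comp_snd, integral_rowNorm hfx]
    simp [hnx]
  -- `r - q` has the moments of `f - q`.
  have hrq := hmom (r - q) (Submodule.sub_mem _ hr hqm) _ hfq fun i j hi hj => by
    have hc : Continuous fun z : ℝ × ℝ => z.1 ^ i * z.2 ^ j := by fun_prop
    simp only [Pi.sub_apply, sub_mul]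
    rw [integral_sub (integrable_mul_continuous hri hc) (integrable_mul_continuous hqi hc),
      integral_sub (integrable_mul_continuous hf hc) (integrable_mul_continuous hqi hc),
      hrm i j hi hj]
  filter_upwards [hb, ae_mem_closedSquare] with z h1 hz
  have h2 := hrq z hz
  rw [Pi.sub_apply, abs_sub_comm] at h2
  have h3 : |f z - r z| ≤ |f z - q z| + |q z - r z| := abs_sub_le _ _ _
  have h4 := mul_le_mul_of_nonneg_left hI hD
  have hR := rowNorm_nonneg fx z.2
  have p1 : 0 ≤ C * rowNorm fx z.2 := mul_nonneg hC hR
  have p2 : 0 ≤ C * nx := mul_nonneg hC hnx0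
  have p3 : 0 ≤ C * ny := mul_nonneg hC hny0
  have p4 : 0 ≤ C * (C * rowNorm fx z.2) := mul_nonneg hC p1
  have p5 : 0 ≤ C * (C * nx) := mul_nonneg hC p2
  have p6 : 0 ≤ D * (rowNorm fx z.2 + 2 * (C * rowNorm fx z.2) + C * (C * rowNorm fx z.2) +
      (C * nx + C * (C * nx)) + (ny + C * ny)) := by positivity
  linarith [mul_nonneg hD hR]

end RaviartThomas

theorem mainTheorem1 (k ℓ : ℕ) (hℓ : 1 ≤ ℓ) (hℓk : ℓ ≤ k + 1)
    (p : ENNReal) (hp : 1 ≤ p) (hp_top : p ≠ ⊤) :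
    (∀ v : ℝ × ℝ → ℝ × ℝ, RaviartThomas.HasMoments v →
      ∃! w : ℝ × ℝ → ℝ × ℝ, RaviartThomas.IsRTInterpolant k v w) ∧
    ∃ C : NNReal, 0 < C ∧
      ∀ (u : ℝ × ℝ → ℝ × ℝ) (d dx dy : ℝ × ℝ → ℝ),
        RaviartThomas.HasMoments u →
        RaviartThomas.HasWeakDiv u d →
        RaviartThomas.MemSobolev ℓ p d →
        RaviartThomas.HasWeakDeriv ℓ 0 d dx →
        RaviartThomas.HasWeakDeriv 0 ℓ d dy →
        (ContinuousOn u RaviartThomas.closedSquare ∨ RaviartThomas.HasNormalTrace u d) →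
        ∀ w : ℝ × ℝ → ℝ × ℝ, RaviartThomas.IsRTInterpolant k u w →
          ∃ e : ℝ × ℝ → ℝ,
            RaviartThomas.HasWeakDiv (fun z => u z - w z) e ∧
            MeasureTheory.MemLp e p RaviartThomas.squareMeasure ∧
            MeasureTheory.eLpNorm e p RaviartThomas.squareMeasure ≤
              C * (MeasureTheory.eLpNorm dx p RaviartThomas.squareMeasure +
                MeasureTheory.eLpNorm dy p RaviartThomas.squareMeasure) := by
  open RaviartThomas MeasureTheory in
  refine ⟨fun v hv => existsUnique_isRTInterpolant k hv, ?_⟩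
  obtain ⟨M, hM, hbound⟩ := exists_abs_sub_le k ℓ hℓ hℓk
  -- The factor `2` is needed because `dx` enters the pointwise bound twice.
  have hC : 0 < (2 * M).toNNReal := Real.toNNReal_pos.2 (by positivity)
  refine ⟨(2 * M).toNNReal, hC, ?_⟩
  intro u d dx dy hu hud hd hdx hdy htr w hw
  have hdi : Integrable d squareMeasure := hd.1.integrable hp
  have hgreen : HasNormalTrace u d :=
    htr.elim (fun hc => hasNormalTrace_of_continuousOn hc hdi hud) id
  have hRT : MemRT k w := hw.1
  have hdivm := hRT.divergence_mem
  have hdivc : Continuous (divergence w) := (contDiff_of_mem_polyLT hdivm).continuous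
  obtain ⟨B, hB⟩ := isCompact_closedSquare.exists_bound_of_continuousOn hdivc.continuousOn
  have hdivLp : MemLp (divergence w) p squareMeasure :=
    MemLp.of_bound hdivc.aestronglyMeasurable B (ae_mem_closedSquare.mono hB)
  refine ⟨fun z => d z - divergence w z, hasWeakDiv_sub hu.1 hdi hud hRT.contDiff,
    hd.1.sub hdivLp, ?_⟩
  have hmeas : ∀ {g : ℝ × ℝ → ℝ}, LocallyIntegrableOn g openSquare volume →
      AEStronglyMeasurable g squareMeasure := fun hg => by
    rw [squareMeasure_eq_restrict_openSquare]
    exact hg.aestronglyMeasurable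
  -- If one of the norms on the right is infinite, there is nothing to prove.
  by_cases hfin : eLpNorm dx p squareMeasure + eLpNorm dy p squareMeasure = ⊤
  · rw [hfin, ENNReal.mul_top (by exact_mod_cast hC.ne')]
    exact le_top
  rw [ENNReal.add_eq_top, not_or] at hfin
  have hdxLp : MemLp dx p squareMeasure := ⟨hmeas hdx.2.1, lt_top_iff_ne_top.2 hfin.1⟩
  have hdyLp : MemLp dy p squareMeasure := ⟨hmeas hdy.2.1, lt_top_iff_ne_top.2 hfin.2⟩
  have hdxi : Integrable dx squareMeasure := hdxLp.integrable hp
  have hdyi : Integrable dy squareMeasure := hdyLp.integrable hp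
  have hae := hbound d dx dy (divergence w) hdi hdxi hdyi hdx hdy hdivm
    fun i j hi hj => hw.integral_divergence_mul hu hgreen hi hj
  have hnorm : ∀ {g : ℝ × ℝ → ℝ}, MemLp g p squareMeasure →
      ‖∫ z, |g z| ∂squareMeasure‖ₑ ≤ eLpNorm g p squareMeasure := fun {g} hg => by
    have h1 : ‖∫ z, |g z| ∂squareMeasure‖ₑ ≤ eLpNorm g 1 squareMeasure := by
      rw [eLpNorm_one_eq_lintegral_enorm]
      refine (enorm_integral_le_lintegral_enorm _).trans_eq ?_
      simp_rw [Real.enorm_abs]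
    exact h1.trans (eLpNorm_le_eLpNorm_of_exponent_le hp hg.1)
  have hp0 : p ≠ 0 := (zero_lt_one.trans_le hp).ne'
  set c := ∫ z, |dx z| ∂squareMeasure + ∫ z, |dy z| ∂squareMeasure with hc
  have hsum : eLpNorm (fun z : ℝ × ℝ => rowNorm dx z.2 + c) p squareMeasure ≤
      2 * (eLpNorm dx p squareMeasure + eLpNorm dy p squareMeasure) := by
    have hadd := eLpNorm_add_le (p := p) (μ := squareMeasure)
      (integrable_comp_snd (integrable_rowNorm hdxi)).aestronglyMeasurable
      (aestronglyMeasurable_const (b := c)) hp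
    have hconst : eLpNorm (fun _ : ℝ × ℝ => c) p squareMeasure ≤
        eLpNorm dx p squareMeasure + eLpNorm dy p squareMeasure := by
      rw [eLpNorm_const c hp0 (IsProbabilityMeasure.ne_zero _)]
      simp only [measure_univ, ENNReal.one_rpow, mul_one]
      exact (enorm_add_le _ _).trans (add_le_add (hnorm hdxLp) (hnorm hdyLp))
    refine hadd.trans ?_
    rw [two_mul]
    exact add_le_add ((eLpNorm_rowNorm_le hp hp_top hdxLp).trans le_self_add) hconst
  have hle := eLpNorm_le_mul_eLpNorm_of_ae_le_mul (p := p) (μ := squareMeasure)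
    (f := fun z => d z - divergence w z) (g := fun z : ℝ × ℝ => rowNorm dx z.2 + c) (c := M) (by
      filter_upwards [hae] with z hz
      rw [Real.norm_eq_abs]
      exact hz.trans (mul_le_mul_of_nonneg_left (le_abs_self _) hM.le))
  refine (hle.trans (mul_le_mul_right hsum _)).trans_eq ?_
  rw [← mul_assoc]
  congr 1
  rw [← ENNReal.ofReal_ofNat 2, ← ENNReal.ofReal_mul hM.le, mul_comm]
  rfl
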